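/- All graphs are finite and simple. A graph is planar if it can be drawn in the plane without crossings. A triangle is a cycle of length $3$ and a $4$-cycle is a cycle of length $4$, cycles being regarded as subgraphs. Two cycles are intersecting if they have at least one common vertex, and adjacent if they have a common edge. A graph $G$ is adaptably $k$-choosable if for every (possibly improper) edge coloring $F: E(G)\to\mathbb{Z}$ and every assignment of lists $L(v)\subset\mathbb{Z}$ with $|L(v)|\ge k$ to the vertices there is a (possibly improper) vertex coloring $c$ with $c(v)\in L(v)$ for all $v\in V(G)$ such that no edge $uv$ satisfies $c(u)=c(v)=F(uv)$. The adaptable choice number $\mathrm{ch}_{ad}(G)$ is the smallest $k$ such that $G$ is adaptably $k$-choosable. A graph $G$ is $(k,d)$-choosable if for every assignment of lists with $|L(v)|\ge k$ for every vertex $v$ and $|L(u)\cap L(v)|\le d$ for every edge $uv$ there is a proper vertex coloring $c$ with $c(v)\in L(v)$ for all $v$. Theorem. Let $G$ be a planar graph in which no two distinct triangles are intersecting and every triangle is adjacent to at most one $4$-cycle. Then $\mathrm{ch}_{ad}(G)\le 3$, and $G$ is $(3,1)$-choosable. -/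

import Mathlib

namespace SimpleGraph

variable {V : Type*}

/-! ### Planar graphs -/

/-- `A` is a polygonal arc in the plane with end points `x` and `y`: it is the union of the
segments `[p 0, p 1], …, [p (n - 1), p n]` of a polygonal path from `x = p 0` to `y = p n` that
never meets itself: consecutive segments share only their common corner, and segments that are
not consecutive are disjoint. -/
def IsPolygonalArc (A : Set (ℝ × ℝ)) (x y : ℝ × ℝ) : Prop :=
  ∃ (n : ℕ) (p : ℕ → ℝ × ℝ), 0 < n ∧ p 0 = x ∧ p n = y ∧
    A = (⋃ i : Fin n, segment ℝ (p i) (p (i + 1))) ∧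
    (∀ i, i < n → p i ≠ p (i + 1)) ∧
    (∀ i, i + 1 < n →
      segment ℝ (p i) (p (i + 1)) ∩ segment ℝ (p (i + 1)) (p (i + 2)) = {p (i + 1)}) ∧
    (∀ i j, i + 1 < j → j < n →
      Disjoint (segment ℝ (p i) (p (i + 1))) (segment ℝ (p j) (p (j + 1))))

/-- A drawing of `G` in the plane without crossings: vertices are distinct points, every edge is
a polygonal arc joining its two end vertices and containing no other vertex, and two distinct
edges meet at most in common end vertices. (The values of `arc` at pairs that are not edges of
`G` play no role.) -/
structure PlaneDrawing (G : SimpleGraph V) where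
  point : V → ℝ × ℝ
  arc : Sym2 V → Set (ℝ × ℝ)
  point_injective : Function.Injective point
  isPolygonalArc_arc : ∀ u v, G.Adj u v → IsPolygonalArc (arc s(u, v)) (point u) (point v)
  mem_of_point_mem_arc : ∀ e ∈ G.edgeSet, ∀ v, point v ∈ arc e → v ∈ e
  exists_of_mem_arc_inter : ∀ e ∈ G.edgeSet, ∀ f ∈ G.edgeSet, e ≠ f →
    ∀ z ∈ arc e ∩ arc f, ∃ v, v ∈ e ∧ v ∈ f ∧ point v = z

/-- A graph is planar if it can be drawn in the plane without crossings. -/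
def IsPlanar (G : SimpleGraph V) : Prop :=
  Nonempty G.PlaneDrawing

/-! ### Cycles as subgraphs -/

/-- The subgraph `C` of `G` is a cycle of length `n`, for short an `n`-cycle. -/
def IsCycleOfLength {G : SimpleGraph V} (C : G.Subgraph) (n : ℕ) : Prop :=
  ∃ (v : V) (w : G.Walk v v), w.IsCycle ∧ w.length = n ∧ w.toSubgraph = C

/-- A triangle of `G` is a cycle of length three. -/
def IsTriangle {G : SimpleGraph V} (T : G.Subgraph) : Prop :=
  IsCycleOfLength T 3

/-- Two cycles (more generally, subgraphs) are intersecting if they have a common vertex. -/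
def Intersecting {G : SimpleGraph V} (C D : G.Subgraph) : Prop :=
  (C.verts ∩ D.verts).Nonempty

/-- Two cycles (more generally, subgraphs) are adjacent if they have a common edge. -/
def AdjacentCycles {G : SimpleGraph V} (C D : G.Subgraph) : Prop :=
  (C.edgeSet ∩ D.edgeSet).Nonempty

/-- No two distinct triangles of `G` are intersecting. -/
def NoIntersectingTriangles (G : SimpleGraph V) : Prop :=
  ∀ S T : G.Subgraph, IsTriangle S → IsTriangle T → S ≠ T → ¬ Intersecting S T

/-- Every triangle of `G` is adjacent to at most one `4`-cycle. -/
def TrianglesAdjacentToAtMostOneFourCycle (G : SimpleGraph V) : Prop :=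
  ∀ T : G.Subgraph, IsTriangle T →
    ∀ C D : G.Subgraph, IsCycleOfLength C 4 → IsCycleOfLength D 4 →
      AdjacentCycles T C → AdjacentCycles T D → C = D

/-! ### Adapted colorings and choosability; colors are integers -/

/-- The (possibly improper) vertex coloring `c` is adapted to the (possibly improper) edge
coloring `F`: no edge has the same color as both of its end vertices. -/
def IsAdapted (G : SimpleGraph V) (F : G.EdgeLabeling ℤ) (c : V → ℤ) : Prop :=
  ∀ (u v : V) (h : G.Adj u v), c u ≠ c v ∨ c v ≠ F ⟨s(u, v), h⟩

/-- `G` is adaptably `k`-choosable: for every edge coloring `F` and all lists `L v` of at least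
`k` colors there is a coloring from the lists that is adapted to `F`. -/
def AdaptablyChoosable (G : SimpleGraph V) (k : ℕ) : Prop :=
  ∀ (F : G.EdgeLabeling ℤ) (L : V → Finset ℤ), (∀ v, k ≤ (L v).card) →
    ∃ c : V → ℤ, G.IsAdapted F c ∧ ∀ v, c v ∈ L v

/-- The adaptable choice number of `G`: the smallest `k` such that `G` is adaptably
`k`-choosable (and `⊤` if there is no such `k`). -/
noncomputable def adaptableChoiceNumber (G : SimpleGraph V) : ℕ∞ :=
  ⨅ k ∈ {k : ℕ | G.AdaptablyChoosable k}, (k : ℕ∞)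

/-- `G` is `(k, d)`-choosable: whenever every vertex has a list of at least `k` colors and the
lists of any two adjacent vertices have at most `d` common colors, there is a proper coloring
from the lists. -/
def SeparatedChoosable (G : SimpleGraph V) (k d : ℕ) : Prop :=
  ∀ L : V → Finset ℤ, (∀ v, k ≤ (L v).card) →
    (∀ u v, G.Adj u v → (L u ∩ L v).card ≤ d) →
    ∃ c : G.Coloring ℤ, ∀ v, c v ∈ L v

end SimpleGraph

section

open Filter Topology Set
open scoped Pointwise

/-! ### The angle subtended by a segment -/

/-! The theorem reduces to sparsity: every induced subgraph on n vertices has at most 2n edges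
(`card_edgeSet_le`). Hall's theorem then assigns each edge to one of its ends so that no vertex
receives more than two edges (`exists_injective_of_card_edgeSet_le`). Each vertex picks from its
three colors one that differs from the colors of the edges assigned to it, so every edge is safe at
one end. Separated choosability follows by giving each edge the only color that the lists of its
ends can share.

For sparsity, vertices of degree at most two are deleted inductively. In minimum degree three, write
E, V, F for the numbers of edges, vertices and faces. Two triangular faces never share an edge, and
at most one edge of a triangle lies on a 4-cycle, so a triangular face borders faces of length at
least five along two of its sides. No two consecutive sides of a face border triangular faces.
Discharging (`four_mul_card_quotient_le`) gives 4F ≤ 2E, and Euler's inequality E + 2 ≤ V + F yields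
E ≤ 2V - 4.

Euler's inequality is extracted from the drawing without the Jordan curve theorem and without
connectivity. Faces are the orbits of the permutation that comes from rotating counterclockwise
around vertices. Given a circulation on the edges, the weighted sum of the angles under which the
segments of the drawing are seen is locally constant off the drawing and jumps across each segment
by 2π times its weight. Its one-sided values therefore form a function on the orbits whose
differences across edges recover the circulation (`exists_leftValue`). Hence the differences of
vertex functions (rank at most V - 1) and of face functions (rank at most F - 1) together span all
edge functions (`card_add_two_le_of_circulation`). -/

/-- The oriented angle under which the segment from `a` to `b` is seen from `x`. -/
noncomputable def subtendedAngle (a b x : ℂ) : ℝ := Complex.arg ((b - x) / (a - x))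

lemma ne_of_notMem_segment {a b x : ℂ} (h : x ∉ segment ℝ a b) : a - x ≠ 0 ∧ b - x ≠ 0 := by
  constructor
  · rintro h0
    rw [sub_eq_zero] at h0
    exact h (h0 ▸ left_mem_segment ℝ a b)
  · rintro h0
    rw [sub_eq_zero] at h0
    exact h (h0 ▸ right_mem_segment ℝ a b)

/-- If the quotient were a real number -r ≤ 0, then x = (r a + b) / (1 + r) would be a convex
combination of the end points. So the branch cut of `Complex.arg` is only met on the segment itself.
-/
lemma div_mem_slitPlane_of_notMem_segment {a b x : ℂ} (h : x ∉ segment ℝ a b) :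
    (b - x) / (a - x) ∈ Complex.slitPlane := by
  by_contra hc
  obtain ⟨ha, hb⟩ := ne_of_notMem_segment h
  rw [Complex.mem_slitPlane_iff_not_le_zero, not_not, Complex.le_def] at hc
  obtain ⟨h1, h2⟩ := hc
  set r : ℝ := -((b - x) / (a - x)).re with hr
  have hr0 : 0 ≤ r := by simpa [hr] using h1
  have hz : (b - x) / (a - x) = -(r : ℂ) := by
    apply Complex.ext
    · simp [hr]
    · simpa using h2
  rw [div_eq_iff ha] at hz
  apply h
  have h1r : (1 : ℝ) + r ≠ 0 := by positivity
  have h1c : (1 : ℂ) + r ≠ 0 := by exact_mod_cast h1r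
  refine ⟨r / (1 + r), 1 / (1 + r), by positivity, by positivity, by field_simp; ring, ?_⟩
  simp only [Complex.real_smul]
  push_cast
  field_simp
  linear_combination hz

lemma continuousAt_arg_div {b x₀ : ℂ} (hb : b - x₀ ≠ 0) :
    ContinuousAt (fun x : ℂ => Complex.arg ((b - x) / (b - x₀))) x₀ := by
  have h1 : ContinuousAt (fun x : ℂ => (b - x) / (b - x₀)) x₀ := by fun_prop
  have h2 : ContinuousAt Complex.arg ((b - x₀) / (b - x₀)) := by
    apply Complex.continuousAt_arg
    rw [div_self hb]
    exact Complex.one_mem_slitPlane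
  exact h2.comp (f := fun x : ℂ => (b - x) / (b - x₀)) h1

lemma continuousAt_subtendedAngle {a b x₀ : ℂ} (h : x₀ ∉ segment ℝ a b) :
    ContinuousAt (subtendedAngle a b) x₀ := by
  obtain ⟨ha, hb⟩ := ne_of_notMem_segment h
  have h1 : ContinuousAt (fun x : ℂ => (b - x) / (a - x)) x₀ := by
    apply ContinuousAt.div _ _ ha <;> fun_prop
  exact (Complex.continuousAt_arg (div_mem_slitPlane_of_notMem_segment h)).comp
    (f := fun x : ℂ => (b - x) / (a - x)) h1

/-- Off the segment, the variation of the subtended angle splits into contributions of the two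
end points. -/
lemma eventually_subtendedAngle_sub {a b x₀ : ℂ} (h : x₀ ∉ segment ℝ a b) :
    ∀ᶠ x in 𝓝 x₀, subtendedAngle a b x - subtendedAngle a b x₀ =
      Complex.arg ((b - x) / (b - x₀)) - Complex.arg ((a - x) / (a - x₀)) := by
  obtain ⟨ha, hb⟩ := ne_of_notMem_segment h
  -- The defect `D` is a multiple of 2π, continuous at x₀ and zero there; being smaller than 2π
  -- nearby, it vanishes nearby.
  set D : ℂ → ℝ := fun x => subtendedAngle a b x - subtendedAngle a b x₀ -
    (Complex.arg ((b - x) / (b - x₀)) - Complex.arg ((a - x) / (a - x₀))) with hD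
  have hc : ContinuousAt D x₀ :=
    ((continuousAt_subtendedAngle h).sub continuousAt_const).sub
      ((continuousAt_arg_div hb).sub (continuousAt_arg_div ha))
  have hD0 : D x₀ = 0 := by simp [hD, div_self ha, div_self hb]
  have h1 : ∀ᶠ x in 𝓝 x₀, D x ∈ Metric.ball (0 : ℝ) (2 * Real.pi) := by
    apply hc.eventually_mem
    rw [hD0]
    exact Metric.ball_mem_nhds _ Real.two_pi_pos
  have hx1 : ∀ᶠ x in 𝓝 x₀, a - x ≠ 0 :=
    (continuous_const.sub continuous_id).continuousAt.eventually_ne ha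
  have hx2 : ∀ᶠ x in 𝓝 x₀, b - x ≠ 0 :=
    (continuous_const.sub continuous_id).continuousAt.eventually_ne hb
  filter_upwards [h1, hx1, hx2] with x hx hax hbx
  have hang : ((D x : ℝ) : Real.Angle) = ((0 : ℝ) : Real.Angle) := by
    simp only [hD, subtendedAngle, Real.Angle.coe_sub]
    rw [Complex.arg_div_coe_angle hbx hax, Complex.arg_div_coe_angle hb ha,
      Complex.arg_div_coe_angle hbx hb, Complex.arg_div_coe_angle hax ha, Real.Angle.coe_zero]
    abel
  rw [Real.Angle.angle_eq_iff_two_pi_dvd_sub] at hang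
  obtain ⟨k, hk⟩ := hang
  rw [sub_zero] at hk
  rw [mem_ball_zero_iff, hk, norm_mul, Real.norm_of_nonneg Real.two_pi_pos.le] at hx
  have hk1 : ‖(k : ℝ)‖ < 1 := by
    by_contra hcon
    push Not at hcon
    nlinarith [Real.two_pi_pos]
  have hk0 : k = 0 := by
    rw [Real.norm_eq_abs] at hk1
    exact Int.abs_lt_one_iff.1 (by exact_mod_cast hk1)
  rw [hk0] at hk
  simp only [Int.cast_zero, mul_zero] at hk
  simpa [hD, sub_eq_zero] using hk

/-! ### Finite systems of segments that meet at end points only -/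

/-- A family of segments in the plane that meet at common end points only. -/
structure SegmentSystem (ι : Type*) where
  a : ι → ℂ
  b : ι → ℂ
  ne : ∀ i, a i ≠ b i
  inter : ∀ i j, i ≠ j → ∀ z ∈ segment ℝ (a i) (b i), z ∈ segment ℝ (a j) (b j) →
    z = a i ∨ z = b i

namespace SegmentSystem

variable {ι : Type*} (S : SegmentSystem ι)

/-- The union of all the segments. -/
def carrier : Set ℂ := ⋃ i, segment ℝ (S.a i) (S.b i)

/-- The sum of the angles under which the segments are seen, weighted by `w`. -/
noncomputable def potential [Fintype ι] (w : ι → ℝ) (x : ℂ) : ℝ :=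
  ∑ i, w i * subtendedAngle (S.a i) (S.b i) x

/-- The hypothesis on `w` says that it is a circulation. The variation of each angle is a difference
of a single function of the end points, so the weighted variations cancel. -/
lemma eventually_potential_eq [Fintype ι] {w : ι → ℝ}
    (hw : ∀ g : ℂ → ℝ, ∑ i, w i * (g (S.b i) - g (S.a i)) = 0) {x₀ : ℂ} (hx : x₀ ∉ S.carrier) :
    ∀ᶠ x in 𝓝 x₀, S.potential w x = S.potential w x₀ := by
  have h1 : ∀ i, ∀ᶠ x in 𝓝 x₀, subtendedAngle (S.a i) (S.b i) x -
      subtendedAngle (S.a i) (S.b i) x₀ = Complex.arg ((S.b i - x) / (S.b i - x₀)) -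
        Complex.arg ((S.a i - x) / (S.a i - x₀)) := fun i =>
    eventually_subtendedAngle_sub fun h => hx (mem_iUnion.2 ⟨i, h⟩)
  filter_upwards [eventually_all.2 h1] with x h
  rw [← sub_eq_zero, potential, potential, ← Finset.sum_sub_distrib,
    ← hw fun v => Complex.arg ((v - x) / (v - x₀))]
  refine Finset.sum_congr rfl fun i _ => ?_
  rw [← mul_sub, h i]

/-- The source of an oriented segment. -/
def src (o : ι × Bool) : ℂ := if o.2 then S.a o.1 else S.b o.1

/-- The target of an oriented segment. -/
def tgt (o : ι × Bool) : ℂ := if o.2 then S.b o.1 else S.a o.1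

/-- The direction of an oriented segment. -/
def dir (o : ι × Bool) : ℂ := S.tgt o - S.src o

lemma dir_ne_zero (o : ι × Bool) : S.dir o ≠ 0 := by
  rcases o with ⟨i, _ | _⟩
  · simpa [dir, src, tgt, sub_eq_zero] using S.ne i
  · simpa [dir, src, tgt, sub_eq_zero] using (S.ne i).symm

lemma segment_src_tgt (o : ι × Bool) :
    segment ℝ (S.src o) (S.tgt o) = segment ℝ (S.a o.1) (S.b o.1) := by
  rcases o with ⟨i, _ | _⟩
  · simp [src, tgt, segment_symm]
  · simp [src, tgt]

lemma src_mem_segment (o : ι × Bool) : S.src o ∈ segment ℝ (S.a o.1) (S.b o.1) := by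
  rw [← S.segment_src_tgt]
  exact left_mem_segment ℝ _ _

/-- A segment that contains the source of an oriented segment starts there in one of its two
orientations. -/
lemma exists_src_eq_of_mem (o : ι × Bool) {i : ι} (h : S.src o ∈ segment ℝ (S.a i) (S.b i)) :
    ∃ o' : ι × Bool, o'.1 = i ∧ S.src o' = S.src o := by
  by_cases hi : i = o.1
  · exact ⟨o, hi.symm, rfl⟩
  · rcases S.inter i o.1 hi _ h (S.src_mem_segment o) with h1 | h1
    · exact ⟨(i, true), rfl, by simp [src] at h1 ⊢; exact h1.symm⟩
    · exact ⟨(i, false), rfl, by simp [src] at h1 ⊢; exact h1.symm⟩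

lemma isClosed_segment (a b : ℂ) : IsClosed (segment ℝ a b) := by
  rw [← convexHull_pair]
  exact ((Set.toFinite {a, b}).isCompact_convexHull ℝ).isClosed

/-- Near the source of an oriented segment, only segments starting there are present. -/
lemma exists_ball_src [Finite ι] (o : ι × Bool) :
    ∃ ε > 0, ∀ x ∈ Metric.ball (S.src o) ε, x ∈ S.carrier →
      ∃ o' : ι × Bool, S.src o' = S.src o ∧ x ∈ segment ℝ (S.src o') (S.tgt o') := by
  set C : Set ℂ := ⋃ i ∈ {i | S.src o ∉ segment ℝ (S.a i) (S.b i)}, segment ℝ (S.a i) (S.b i)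
  have hC : IsClosed C := (Set.toFinite _).isClosed_biUnion fun i _ => isClosed_segment _ _
  have hv : S.src o ∈ Cᶜ := by simp [C]
  obtain ⟨ε, hε, hball⟩ := Metric.isOpen_iff.1 hC.isOpen_compl _ hv
  refine ⟨ε, hε, fun x hx hxc => ?_⟩
  obtain ⟨i, hi⟩ := mem_iUnion.1 hxc
  have hvi : S.src o ∈ segment ℝ (S.a i) (S.b i) := by
    by_contra hvi
    exact hball hx (mem_biUnion (show i ∈ {i | S.src o ∉ segment ℝ (S.a i) (S.b i)} from hvi) hi)
  obtain ⟨o', rfl, ho'⟩ := S.exists_src_eq_of_mem o hvi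
  exact ⟨o', ho', by rwa [S.segment_src_tgt]⟩

end SegmentSystem

/-! ### One-sided values of locally constant functions -/

lemma eq_of_isPreconnected_of_eventually_eq {X : Type*} [TopologicalSpace X] {f : X → ℝ}
    {K s : Set X} (hf : ∀ x ∉ K, ∀ᶠ y in 𝓝 x, f y = f x) (hs : IsPreconnected s)
    (hsK : ∀ x ∈ s, x ∉ K) {x y : X} (hx : x ∈ s) (hy : y ∈ s) : f x = f y := by
  refine hs.induction₂ (fun x y => f x = f y) ?_ ?_ ?_ hx hy
  · intro x hx
    filter_upwards [mem_nhdsWithin_of_mem_nhds (hf x (hsK x hx))] with y hy using hy.symm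
  · intro x y z _ _ _ h1 h2
    exact h1.trans h2
  · intro x y _ _ h
    exact h.symm

/-- The function `f` is constantly `c` at the points that are close to `x` in direction `v`. -/
def SideValue (f : ℂ → ℝ) (x v : ℂ) (c : ℝ) : Prop := ∀ᶠ s : ℝ in 𝓝[>] 0, f (x + s * v) = c

lemma SideValue.unique {f : ℂ → ℝ} {x v : ℂ} {c d : ℝ} (hc : SideValue f x v c)
    (hd : SideValue f x v d) : c = d := by
  obtain ⟨s, h1, h2⟩ := (hc.and hd).exists
  exact h1.symm.trans h2

namespace SegmentSystem

variable {ι : Type*} (S : SegmentSystem ι)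

lemma notMem_segment_of_mem_openSegment {i j : ι} (hij : i ≠ j) {z : ℂ}
    (hz : z ∈ openSegment ℝ (S.a i) (S.b i)) : z ∉ segment ℝ (S.a j) (S.b j) := by
  intro h
  rcases S.inter i j hij z (openSegment_subset_segment _ _ _ hz) h with rfl | rfl
  · exact S.ne i (left_mem_openSegment_iff.1 hz)
  · exact S.ne i (right_mem_openSegment_iff.1 hz)

/-- A function that is locally constant off the segments has the same one-sided values at all
inner points of a segment. -/
lemma exists_sideValue [Finite ι] {f : ℂ → ℝ} (hf : ∀ x ∉ S.carrier, ∀ᶠ y in 𝓝 x, f y = f x)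
    (o : ι × Bool) {x y : ℂ} (hx : x ∈ openSegment ℝ (S.a o.1) (S.b o.1))
    (hy : y ∈ openSegment ℝ (S.a o.1) (S.b o.1)) :
    ∃ c, SideValue f x (Complex.I * S.dir o) c ∧ SideValue f y (Complex.I * S.dir o) c := by
  set i := o.1 with hi
  set v := Complex.I * S.dir o with hv
  have hv0 : v ≠ 0 := mul_ne_zero Complex.I_ne_zero (S.dir_ne_zero o)
  set C : Set ℂ := ⋃ j ∈ {j | i ≠ j}, segment ℝ (S.a j) (S.b j)
  have hC : IsClosed C := (Set.toFinite _).isClosed_biUnion fun i _ => isClosed_segment _ _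
  have hsub : segment ℝ x y ⊆ openSegment ℝ (S.a i) (S.b i) :=
    (convex_openSegment _ _).segment_subset hx hy
  have hM : segment ℝ x y ⊆ Cᶜ := by
    intro z hz hzC
    simp only [C, mem_iUnion] at hzC
    obtain ⟨j, hj, hzj⟩ := hzC
    exact S.notMem_segment_of_mem_openSegment hj (hsub hz) hzj
  have hMc : IsCompact (segment ℝ x y) := by
    rw [← convexHull_pair]
    exact (Set.toFinite {x, y}).isCompact_convexHull ℝ
  obtain ⟨δ, hδ, hth⟩ := hMc.exists_thickening_subset_open hC.isOpen_compl hM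
  set η := δ / ‖v‖ with hη
  have hη0 : 0 < η := div_pos hδ (norm_pos_iff.2 hv0)
  -- A thin open strip on the left of [x, y]. It is convex, misses its own segment because it is
  -- displaced in the normal direction, and misses all others because it stays within distance δ of
  -- [x, y].
  set A : Set ℂ := segment ℝ x y + (fun s : ℝ => (s : ℂ) * v) '' Ioo 0 η with hA
  have hAconv : Convex ℝ A := by
    apply (convex_segment x y).add
    apply (convex_Ioo (0 : ℝ) η).is_linear_image
    constructor
    · intro p q; push_cast; ring
    · intro p q; simp [mul_assoc]
  have hAK : ∀ z ∈ A, z ∉ S.carrier := by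
    rintro _ ⟨z, hz, _, ⟨s, hs, rfl⟩, rfl⟩ hmem
    simp only at hmem
    obtain ⟨j, hj⟩ := mem_iUnion.1 hmem
    by_cases hij : i = j
    · subst hij
      have hz' := openSegment_subset_segment _ _ _ (hsub hz)
      rw [hi, ← S.segment_src_tgt, segment_eq_image'] at hj hz'
      obtain ⟨t, -, ht⟩ := hj
      obtain ⟨t', -, ht'⟩ := hz'
      have hd := S.dir_ne_zero o
      have h1 : ((t : ℂ) - t' - s * Complex.I) * S.dir o = 0 := by
        simp only [Complex.real_smul] at ht ht'
        rw [hv] at ht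
        simp only [dir] at ht ⊢
        linear_combination ht - ht'
      have h2 := (mul_eq_zero.1 h1).resolve_right hd
      have h3 := congrArg Complex.im h2
      simp at h3
      exact hs.1.ne' h3
    · have h1 : z + s * v ∈ Metric.thickening δ (segment ℝ x y) := by
        rw [Metric.mem_thickening_iff]
        refine ⟨z, hz, ?_⟩
        rw [dist_eq_norm, add_sub_cancel_left, norm_mul, Complex.norm_real,
          Real.norm_of_nonneg hs.1.le]
        calc s * ‖v‖ < η * ‖v‖ := by
              apply mul_lt_mul_of_pos_right hs.2 (norm_pos_iff.2 hv0)
          _ = δ := by rw [hη]; field_simp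
      exact hth h1 (mem_biUnion (show j ∈ {j | i ≠ j} from hij) hj)
  have key : ∀ z ∈ segment ℝ x y, ∀ s ∈ Ioo 0 η, f (z + s * v) = f (x + (η / 2 : ℝ) * v) := by
    intro z hz s hs
    apply eq_of_isPreconnected_of_eventually_eq hf hAconv.isPreconnected hAK
    · exact add_mem_add hz ⟨s, hs, rfl⟩
    · exact add_mem_add (left_mem_segment _ _ _) ⟨η / 2, ⟨by positivity, by linarith⟩, rfl⟩
  refine ⟨f (x + (η / 2 : ℝ) * v), ?_, ?_⟩
  · filter_upwards [Ioo_mem_nhdsGT hη0] with s hs using key x (left_mem_segment _ _ _) s hs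
  · filter_upwards [Ioo_mem_nhdsGT hη0] with s hs using key y (right_mem_segment _ _ _) s hs

end SegmentSystem

/-! ### The jump of the subtended angle across a segment -/

/-- On the perpendicular bisector both end points are equally far, so the quotient runs on the unit
circle. Near s = 0 it is close to -1, above the branch cut for s > 0 and below it for s < 0: this is
the source of the jump 2π. -/
lemma subtendedAngle_midpoint_add {a b : ℂ} (hab : a ≠ b) (s : ℝ) :
    subtendedAngle a b (midpoint ℝ a b + s * (Complex.I * (b - a))) =
      Complex.arg ⟨(s ^ 2 - 1 / 4) / (s ^ 2 + 1 / 4), s / (s ^ 2 + 1 / 4)⟩ := by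
  have hu : b - a ≠ 0 := sub_ne_zero.2 hab.symm
  have hs : (s ^ 2 + 1 / 4 : ℝ) ≠ 0 := by positivity
  have hs' : ((s : ℂ) ^ 2 + 1 / 4) ≠ 0 := by
    intro h
    exact hs (by exact_mod_cast (show ((s ^ 2 + 1 / 4 : ℝ) : ℂ) = 0 by push_cast; exact h))
  have hmid : midpoint ℝ a b = (a + b) / 2 := by
    rw [midpoint_eq_smul_add, Complex.real_smul, invOf_eq_inv]; push_cast; ring
  have hI : ((-1 : ℂ) / 2 - s * Complex.I) ≠ 0 := by
    intro h
    have := congrArg Complex.re h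
    norm_num at this
  have h1 : a - (midpoint ℝ a b + s * (Complex.I * (b - a))) =
      ((-1 : ℂ) / 2 - s * Complex.I) * (b - a) := by rw [hmid]; ring
  have h2 : b - (midpoint ℝ a b + s * (Complex.I * (b - a))) =
      ((1 : ℂ) / 2 - s * Complex.I) * (b - a) := by rw [hmid]; ring
  have h3 : (⟨(s ^ 2 - 1 / 4) / (s ^ 2 + 1 / 4), s / (s ^ 2 + 1 / 4)⟩ : ℂ) =
      ((s ^ 2 - 1 / 4 : ℂ) + s * Complex.I) / (s ^ 2 + 1 / 4) := by
    rw [Complex.mk_eq_add_mul_I]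
    push_cast
    field_simp
  rw [subtendedAngle, h1, h2, mul_div_mul_right _ _ hu, h3]
  congr 1
  rw [div_eq_div_iff hI hs']
  linear_combination (s : ℂ) ^ 2 * Complex.I_sq

lemma continuous_jump : Continuous
    (fun s : ℝ => (⟨(s ^ 2 - 1 / 4) / (s ^ 2 + 1 / 4), s / (s ^ 2 + 1 / 4)⟩ : ℂ)) := by
  have h : ∀ s : ℝ, s ^ 2 + 1 / 4 ≠ 0 := fun s => by positivity
  have h1 : Continuous fun s : ℝ =>
      Complex.equivRealProdCLM.symm ((s ^ 2 - 1 / 4) / (s ^ 2 + 1 / 4), s / (s ^ 2 + 1 / 4)) := by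
    apply Complex.equivRealProdCLM.symm.continuous.comp
    apply Continuous.prodMk
    · exact Continuous.div (by fun_prop) (by fun_prop) h
    · exact Continuous.div (by fun_prop) (by fun_prop) h
  exact h1

lemma tendsto_subtendedAngle_left {a b : ℂ} (hab : a ≠ b) :
    Tendsto (fun s : ℝ => subtendedAngle a b (midpoint ℝ a b + s * (Complex.I * (b - a))))
      (𝓝[>] 0) (𝓝 Real.pi) := by
  simp_rw [subtendedAngle_midpoint_add hab]
  have h1 := Complex.continuousWithinAt_arg_of_re_neg_of_im_zero (z := ⟨-1, 0⟩) (by simp) rfl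
  have h2 : Complex.arg ⟨-1, 0⟩ = Real.pi := Complex.arg_eq_pi_iff.2 ⟨by simp, rfl⟩
  rw [ContinuousWithinAt, h2] at h1
  refine h1.comp (tendsto_nhdsWithin_iff.2 ⟨?_, ?_⟩)
  · have := (continuous_jump.tendsto 0).mono_left (nhdsWithin_le_nhds (s := Ioi 0))
    norm_num at this
    exact this
  · filter_upwards [self_mem_nhdsWithin] with s hs
    have : 0 < s := hs
    show 0 ≤ s / (s ^ 2 + 1 / 4)
    positivity

lemma tendsto_subtendedAngle_right {a b : ℂ} (hab : a ≠ b) :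
    Tendsto (fun s : ℝ => subtendedAngle a b (midpoint ℝ a b + s * (Complex.I * (a - b))))
      (𝓝[>] 0) (𝓝 (-Real.pi)) := by
  have h0 : ∀ s : ℝ, midpoint ℝ a b + s * (Complex.I * (a - b)) =
      midpoint ℝ a b + ((-s : ℝ) : ℂ) * (Complex.I * (b - a)) := by
    intro s; push_cast; ring
  simp_rw [h0, subtendedAngle_midpoint_add hab]
  have h1 := Complex.tendsto_arg_nhdsWithin_im_neg_of_re_neg_of_im_zero (z := ⟨-1, 0⟩)
    (by simp) rfl
  refine h1.comp (tendsto_nhdsWithin_iff.2 ⟨?_, ?_⟩)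
  · have := ((continuous_jump.comp continuous_neg).tendsto 0).mono_left
      (nhdsWithin_le_nhds (s := Ioi 0))
    norm_num at this
    convert this using 2 with s
    simp
  · filter_upwards [self_mem_nhdsWithin] with s hs
    have : 0 < s := hs
    show -s / ((-s) ^ 2 + 1 / 4) < 0
    apply div_neg_of_neg_of_pos
    · linarith
    · positivity

end

section

open Filter Topology Set
open scoped Pointwise

/-! ### The counterclockwise angle between two directions -/

/-- The angle in `(0, 2π]` by which `u` has to be turned counterclockwise to point in the
direction of `v`. -/
noncomputable def ccwAngle (u v : ℂ) : ℝ :=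
  if 0 < Complex.arg (v / u) then Complex.arg (v / u) else Complex.arg (v / u) + 2 * Real.pi

lemma ccwAngle_pos (u v : ℂ) : 0 < ccwAngle u v := by
  unfold ccwAngle
  split_ifs with h
  · exact h
  · linarith [Complex.neg_pi_lt_arg (v / u), Real.pi_pos]

lemma ccwAngle_le (u v : ℂ) : ccwAngle u v ≤ 2 * Real.pi := by
  unfold ccwAngle
  split_ifs with h
  · linarith [Complex.arg_le_pi (v / u), Real.pi_pos]
  · linarith

lemma exp_ccwAngle (u v : ℂ) :
    Complex.exp (ccwAngle u v * Complex.I) = Complex.exp (Complex.arg (v / u) * Complex.I) := by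
  unfold ccwAngle
  split_ifs with h
  · rfl
  · push_cast
    rw [add_mul, Complex.exp_add, Complex.exp_two_pi_mul_I, mul_one]

lemma exists_eq_mul_exp_ccwAngle {u v : ℂ} (hu : u ≠ 0) (hv : v ≠ 0) :
    ∃ r : ℝ, 0 < r ∧ v = r * Complex.exp (ccwAngle u v * Complex.I) * u := by
  refine ⟨‖v / u‖, norm_pos_iff.2 (div_ne_zero hv hu), ?_⟩
  rw [exp_ccwAngle, Complex.norm_mul_exp_arg_mul_I, div_mul_cancel₀ _ hu]

lemma ccwAngle_eq {u v : ℂ} (hu : u ≠ 0) {r β : ℝ} (hr : 0 < r) (hβ : 0 < β)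
    (hβ' : β ≤ 2 * Real.pi) (hv : v = r * Complex.exp (β * Complex.I) * u) :
    ccwAngle u v = β := by
  have h1 : v / u = r * Complex.exp (β * Complex.I) := by
    rw [hv, mul_div_cancel_right₀ _ hu]
  have hpi := Real.pi_pos
  unfold ccwAngle
  rcases le_or_gt β Real.pi with hle | hlt
  · have h2 : Complex.arg (v / u) = β := by
      rw [h1, Complex.arg_real_mul _ hr, Complex.arg_exp_mul_I]
      exact (toIocMod_eq_self _).2 ⟨by linarith, by linarith⟩
    rw [h2, if_pos hβ]
  · have h2 : Complex.arg (v / u) = β - 2 * Real.pi := by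
      have h3 : Complex.exp (β * Complex.I) =
          Complex.exp (((β - 2 * Real.pi : ℝ) : ℂ) * Complex.I) := by
        push_cast
        rw [sub_mul, Complex.exp_sub, Complex.exp_two_pi_mul_I, div_one]
      rw [h1, h3, Complex.arg_real_mul _ hr, Complex.arg_exp_mul_I]
      exact (toIocMod_eq_self _).2 ⟨by linarith, by linarith⟩
    rw [h2, if_neg (by linarith)]
    ring

/-! ### Sectors between consecutive segments at a common end point -/

namespace SegmentSystem

variable {ι : Type*} (S : SegmentSystem ι)

/-- The sector between two directions at a common source contains no point of a segment close to
the source, provided that no segment at the source points into it. -/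
lemma exists_sector_disjoint [Finite ι] (o₁ o₂ : ι × Bool)
    (hmin : ∀ o₃, S.src o₃ = S.src o₁ →
      ccwAngle (S.dir o₁) (S.dir o₂) ≤ ccwAngle (S.dir o₁) (S.dir o₃)) :
    ∃ ε > 0, ∀ ρ ∈ Ioo (0 : ℝ) ε, ∀ β ∈ Ioo 0 (ccwAngle (S.dir o₁) (S.dir o₂)),
      S.src o₁ + ρ * Complex.exp (β * Complex.I) * S.dir o₁ ∉ S.carrier := by
  obtain ⟨ε, hε, hball⟩ := S.exists_ball_src o₁
  have hd := S.dir_ne_zero o₁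
  have hd' := norm_pos_iff.2 hd
  refine ⟨ε / ‖S.dir o₁‖, div_pos hε hd', fun ρ hρ β hβ hmem => ?_⟩
  have hdist : S.src o₁ + ρ * Complex.exp (β * Complex.I) * S.dir o₁ ∈
      Metric.ball (S.src o₁) ε := by
    rw [Metric.mem_ball, dist_eq_norm, add_sub_cancel_left, norm_mul, norm_mul,
      Complex.norm_real, Complex.norm_exp_ofReal_mul_I, mul_one, Real.norm_of_nonneg hρ.1.le]
    exact (lt_div_iff₀ hd').1 hρ.2
  obtain ⟨o₃, ho₃, hx⟩ := hball _ hdist hmem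
  rw [segment_eq_image'] at hx
  obtain ⟨τ, hτ, hxτ⟩ := hx
  simp only [Complex.real_smul] at hxτ
  rw [ho₃, add_right_inj] at hxτ
  have hne : (ρ : ℂ) * Complex.exp (β * Complex.I) * S.dir o₁ ≠ 0 :=
    mul_ne_zero (mul_ne_zero (by exact_mod_cast hρ.1.ne') (Complex.exp_ne_zero _)) hd
  have hτ0 : τ ≠ 0 := by
    rintro rfl
    rw [Complex.ofReal_zero, zero_mul] at hxτ
    exact hne hxτ.symm
  have hτpos : 0 < τ := lt_of_le_of_ne hτ.1 hτ0.symm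
  have hτc : (τ : ℂ) ≠ 0 := by exact_mod_cast hτ0
  have h3 : S.dir o₃ = ((ρ / τ : ℝ) : ℂ) * Complex.exp (β * Complex.I) * S.dir o₁ := by
    have : (τ : ℂ) * S.dir o₃ = ρ * Complex.exp (β * Complex.I) * S.dir o₁ := by
      rw [← hxτ, dir, ho₃]
    push_cast
    field_simp
    linear_combination this
  have h4 := ccwAngle_eq hd (div_pos hρ.1 hτpos) hβ.1 (hβ.2.le.trans (ccwAngle_le _ _)) h3
  have h5 := hmin o₃ ho₃
  rw [h4] at h5
  exact absurd hβ.2 (not_lt.2 h5)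

lemma tendsto_add_mul_I (t κ : ℝ) :
    Tendsto (fun s : ℝ => (t : ℂ) + κ * s * Complex.I) (𝓝[>] 0) (𝓝 (t : ℂ)) := by
  have h : Continuous fun s : ℝ => (t : ℂ) + κ * s * Complex.I := by fun_prop
  have := (h.tendsto 0).mono_left (nhdsWithin_le_nhds (s := Ioi 0))
  simpa using this

lemma tendsto_arg_add_mul_I {t : ℝ} (ht : 0 < t) (κ : ℝ) :
    Tendsto (fun s : ℝ => Complex.arg ((t : ℂ) + κ * s * Complex.I)) (𝓝[>] 0) (𝓝 0) := by
  have h : ContinuousAt Complex.arg (t : ℂ) :=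
    Complex.continuousAt_arg (Complex.ofReal_mem_slitPlane.2 ht)
  have h1 := h.tendsto.comp (tendsto_add_mul_I t κ)
  rwa [Complex.arg_ofReal_of_nonneg ht.le] at h1

/-- Two directions at a common source with no segment in between have a common value in
between. -/
lemma exists_sideValue_sector [Finite ι] {f : ℂ → ℝ}
    (hf : ∀ x ∉ S.carrier, ∀ᶠ y in 𝓝 x, f y = f x) (o₁ o₂ : ι × Bool)
    (hmin : ∀ o₃, S.src o₃ = S.src o₁ →
      ccwAngle (S.dir o₁) (S.dir o₂) ≤ ccwAngle (S.dir o₁) (S.dir o₃)) :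
    ∃ c, ∃ δ > 0, ∀ t ∈ Ioo (0 : ℝ) δ,
      SideValue f (S.src o₁ + t * S.dir o₁) (Complex.I * S.dir o₁) c ∧
      SideValue f (S.src o₁ + t * S.dir o₂) (-(Complex.I * S.dir o₂)) c := by
  obtain ⟨ε, hε, hsec⟩ := S.exists_sector_disjoint o₁ o₂ hmin
  set α := ccwAngle (S.dir o₁) (S.dir o₂) with hα
  have hα0 : 0 < α := ccwAngle_pos _ _
  obtain ⟨r, hr, hd₂⟩ := exists_eq_mul_exp_ccwAngle (S.dir_ne_zero o₁) (S.dir_ne_zero o₂)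
  rw [← hα] at hd₂
  -- Polar coordinates at the common source, with `S.dir o₁` as axis; the open sector is the image
  -- of a rectangle, hence preconnected, and avoids all segments.
  set φ : ℝ × ℝ → ℂ := fun q => S.src o₁ + q.1 * Complex.exp (q.2 * Complex.I) * S.dir o₁
    with hφ
  have hφc : Continuous φ := by fun_prop
  have hpre : IsPreconnected (φ '' (Ioo 0 ε ×ˢ Ioo 0 α)) :=
    ((isPreconnected_Ioo.prod isPreconnected_Ioo).image _ hφc.continuousOn)
  have hK : ∀ x ∈ φ '' (Ioo 0 ε ×ˢ Ioo 0 α), x ∉ S.carrier := by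
    rintro _ ⟨q, hq, rfl⟩
    exact hsec q.1 hq.1 q.2 hq.2
  have key : ∀ ρ ∈ Ioo 0 ε, ∀ β ∈ Ioo 0 α, f (φ (ρ, β)) = f (φ (ε / 2, α / 2)) := by
    intro ρ hρ β hβ
    apply eq_of_isPreconnected_of_eventually_eq hf hpre hK
    · exact ⟨(ρ, β), ⟨hρ, hβ⟩, rfl⟩
    · exact ⟨(ε / 2, α / 2), ⟨⟨by positivity, by linarith⟩, ⟨by positivity, by linarith⟩⟩, rfl⟩
  have hpolar : ∀ z : ℂ, z = ‖z‖ * Complex.exp (Complex.arg z * Complex.I) := fun z =>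
    (Complex.norm_mul_exp_arg_mul_I z).symm
  refine ⟨f (φ (ε / 2, α / 2)), min ε (ε / r), lt_min hε (div_pos hε hr), fun t ht => ⟨?_, ?_⟩⟩
  · have htε : t < ε := ht.2.trans_le (min_le_left _ _)
    have h1 := (tendsto_add_mul_I t 1).norm
    rw [Complex.norm_real, Real.norm_of_nonneg ht.1.le] at h1
    filter_upwards [h1.eventually (Ioo_mem_nhds ht.1 htε),
      (tendsto_arg_add_mul_I ht.1 1).eventually (Iio_mem_nhds hα0), self_mem_nhdsWithin]
      with s hs1 hs2 (hs3 : 0 < s)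
    have him : 0 < Complex.arg ((t : ℂ) + (1 : ℝ) * s * Complex.I) := by
      apply lt_of_le_of_ne
      · rw [Complex.arg_nonneg_iff]
        simpa using hs3.le
      · intro h0
        have := (Complex.arg_eq_zero_iff.1 h0.symm).2
        simp at this
        exact hs3.ne' this
    rw [← key _ hs1 _ ⟨him, hs2⟩, hφ]
    simp only
    rw [← hpolar]
    congr 1
    push_cast
    ring
  -- A point just to the right of the second segment has polar angle slightly below α. The factor r
  -- rescales radii, as `S.dir o₂` is r times the rotated `S.dir o₁`.
  · have htε : t * r < ε := (lt_div_iff₀ hr).1 (ht.2.trans_le (min_le_right _ _))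
    have h1 := ((tendsto_add_mul_I t (-1)).norm).mul_const r
    rw [Complex.norm_real, Real.norm_of_nonneg ht.1.le] at h1
    filter_upwards [h1.eventually (Ioo_mem_nhds (mul_pos ht.1 hr) htε),
      (tendsto_arg_add_mul_I ht.1 (-1)).eventually (Ioi_mem_nhds (neg_lt_zero.2 hα0)),
      self_mem_nhdsWithin] with s hs1 hs2 (hs3 : 0 < s)
    have him : Complex.arg ((t : ℂ) + (-1 : ℝ) * s * Complex.I) < 0 := by
      rw [Complex.arg_neg_iff]
      simpa using hs3
    have hs2' : -α < Complex.arg ((t : ℂ) + (-1 : ℝ) * s * Complex.I) := hs2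
    rw [← key _ hs1 (Complex.arg ((t : ℂ) + (-1 : ℝ) * s * Complex.I) + α)
      ⟨by linarith, by linarith⟩, hφ]
    simp only
    have h2 := hpolar ((t : ℂ) + (-1 : ℝ) * s * Complex.I)
    congr 1
    rw [hd₂]
    push_cast at h2 ⊢
    rw [add_mul, Complex.exp_add]
    linear_combination (r * Complex.exp (α * Complex.I) * S.dir o₁) * h2

/-- The reversed oriented segment. -/
def rev (o : ι × Bool) : ι × Bool := (o.1, !o.2)

lemma add_smul_dir_mem (o : ι × Bool) {t : ℝ} (ht : t ∈ Ioo (0 : ℝ) 1) :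
    S.src o + t * S.dir o ∈ openSegment ℝ (S.a o.1) (S.b o.1) := by
  have h : S.src o + t * S.dir o ∈ openSegment ℝ (S.src o) (S.tgt o) := by
    rw [openSegment_eq_image']
    exact ⟨t, ht, by simp [dir]⟩
  rcases o with ⟨i, _ | _⟩
  · rw [openSegment_symm]
    simpa [src, tgt] using h
  · simpa [src, tgt] using h

lemma midpoint_mem (i : ι) : midpoint ℝ (S.a i) (S.b i) ∈ openSegment ℝ (S.a i) (S.b i) :=
  ⟨1 / 2, 1 / 2, by norm_num, by norm_num, by norm_num, by
    rw [midpoint_eq_smul_add, smul_add, invOf_eq_inv, one_div]⟩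

lemma dir_rev (o : ι × Bool) : S.dir (rev o) = -S.dir o := by
  rcases o with ⟨i, _ | _⟩ <;> simp [dir, src, tgt, rev]

/-- The values of a circulation: a function on oriented segments, to be thought of as the value of
the weighted sum of angles on the left of the oriented segment. -/
theorem exists_leftValue [Fintype ι] {w : ι → ℝ}
    (hw : ∀ g : ℂ → ℝ, ∑ i, w i * (g (S.b i) - g (S.a i)) = 0) :
    ∃ l : ι × Bool → ℝ, (∀ i, l (i, true) - l (i, false) = 2 * Real.pi * w i) ∧
      ∀ o₁ o₂, S.src o₂ = S.src o₁ → (∀ o₃, S.src o₃ = S.src o₁ →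
        ccwAngle (S.dir o₁) (S.dir o₂) ≤ ccwAngle (S.dir o₁) (S.dir o₃)) →
        l o₁ = l (rev o₂) := by
  classical
  have hf : ∀ x ∉ S.carrier, ∀ᶠ y in 𝓝 x, S.potential w y = S.potential w x :=
    fun x hx => S.eventually_potential_eq hw hx
  have hex : ∀ o : ι × Bool, ∃ c, ∀ x ∈ openSegment ℝ (S.a o.1) (S.b o.1),
      SideValue (S.potential w) x (Complex.I * S.dir o) c := by
    intro o
    obtain ⟨c, hc, -⟩ := S.exists_sideValue hf o (S.midpoint_mem o.1) (S.midpoint_mem o.1)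
    refine ⟨c, fun x hx => ?_⟩
    obtain ⟨d, hd, hd'⟩ := S.exists_sideValue hf o (S.midpoint_mem o.1) hx
    rwa [hc.unique hd]
  choose l hl using hex
  refine ⟨l, fun i => ?_, fun o₁ o₂ hsrc hmin => ?_⟩
  -- At the midpoint of segment i all other terms are continuous, with sum R, and only the i-th
  -- angle jumps, from π on the left to -π on the right.
  · set m := midpoint ℝ (S.a i) (S.b i) with hm
    set R := ∑ j ∈ Finset.univ.erase i, w j * subtendedAngle (S.a j) (S.b j) m with hR
    have hcont : ∀ v : ℂ, Tendsto (fun s : ℝ => ∑ j ∈ Finset.univ.erase i,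
        w j * subtendedAngle (S.a j) (S.b j) (m + s * v)) (𝓝[>] 0) (𝓝 R) := by
      intro v
      apply tendsto_finsetSum
      intro j hj
      apply Tendsto.const_mul
      have h1 := continuousAt_subtendedAngle
        (S.notMem_segment_of_mem_openSegment (Finset.ne_of_mem_erase hj).symm (S.midpoint_mem i))
      have h2 : Tendsto (fun s : ℝ => m + s * v) (𝓝[>] 0) (𝓝 m) := by
        have h : Continuous fun s : ℝ => m + s * v := by fun_prop
        have := (h.tendsto 0).mono_left (nhdsWithin_le_nhds (s := Ioi 0))
        simpa using this
      exact h1.tendsto.comp h2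
    have hsplit : ∀ x, S.potential w x = w i * subtendedAngle (S.a i) (S.b i) x +
        ∑ j ∈ Finset.univ.erase i, w j * subtendedAngle (S.a j) (S.b j) x := fun x =>
      (Finset.add_sum_erase _ _ (Finset.mem_univ i)).symm
    have hval : ∀ (v : ℂ) (c θ : ℝ), SideValue (S.potential w) m v c →
        Tendsto (fun s : ℝ => subtendedAngle (S.a i) (S.b i) (m + s * v)) (𝓝[>] 0) (𝓝 θ) →
        c = w i * θ + R := by
      intro v c θ hc hθ
      have h1 : Tendsto (fun s : ℝ => S.potential w (m + s * v)) (𝓝[>] 0)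
          (𝓝 (w i * θ + R)) := by
        simp_rw [hsplit]
        exact (hθ.const_mul _).add (hcont v)
      have h2 : Tendsto (fun s : ℝ => S.potential w (m + s * v)) (𝓝[>] 0) (𝓝 c) :=
        tendsto_nhds_of_eventually_eq hc
      exact tendsto_nhds_unique h2 h1
    have h1 := hval _ _ _ (hl (i, true) m (S.midpoint_mem i))
      (tendsto_subtendedAngle_left (S.ne i))
    have h2 := hval _ _ _ (hl (i, false) m (S.midpoint_mem i))
      (tendsto_subtendedAngle_right (S.ne i))
    rw [h1, h2]
    ring
  -- The left side of `o₁` and the right side of `o₂` near the source lie in the same empty sector.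
  · obtain ⟨c, δ, hδ, h⟩ := S.exists_sideValue_sector hf o₁ o₂ hmin
    have hmin' : 0 < min δ 1 := lt_min hδ one_pos
    have hlt : min δ 1 / 2 < min δ 1 := by linarith
    obtain ⟨h1, h2⟩ := h (min δ 1 / 2) ⟨by positivity, hlt.trans_le (min_le_left _ _)⟩
    have ht : min δ 1 / 2 ∈ Ioo (0 : ℝ) 1 := ⟨by positivity, hlt.trans_le (min_le_right _ _)⟩
    have h3 := hl o₁ _ (S.add_smul_dir_mem o₁ ht)
    have h4 := hl (rev o₂) _ (S.add_smul_dir_mem o₂ ht)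
    rw [S.dir_rev, mul_neg, hsrc] at h4
    exact (h3.unique h1).trans (h4.unique h2).symm

end SegmentSystem

end

section

open Filter Topology Set

/-! ### Rotations -/

/-- With a full turn instead of 0 here, a direction is its own successor only as a last resort, when
it is the only one at its point. -/
lemma ccwAngle_self {u : ℂ} (hu : u ≠ 0) : ccwAngle u u = 2 * Real.pi :=
  ccwAngle_eq hu one_pos Real.two_pi_pos le_rfl (by
    push_cast
    rw [Complex.exp_two_pi_mul_I]
    ring)

lemma ccwAngle_add {u v w : ℂ} (hu : u ≠ 0) (hv : v ≠ 0) (hw : w ≠ 0)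
    (h : ccwAngle u v + ccwAngle v w ≤ 2 * Real.pi) :
    ccwAngle u w = ccwAngle u v + ccwAngle v w := by
  obtain ⟨r, hr, h1⟩ := exists_eq_mul_exp_ccwAngle hu hv
  obtain ⟨s, hs, h2⟩ := exists_eq_mul_exp_ccwAngle hv hw
  refine ccwAngle_eq hu (mul_pos hs hr) (add_pos (ccwAngle_pos _ _) (ccwAngle_pos _ _)) h ?_
  push_cast
  rw [add_mul, Complex.exp_add]
  calc w = s * Complex.exp (ccwAngle v w * Complex.I) * v := h2
    _ = s * Complex.exp (ccwAngle v w * Complex.I) *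
        (r * Complex.exp (ccwAngle u v * Complex.I) * u) := by rw [← h1]
    _ = _ := by ring

lemma ccwAngle_add_sub {u v w : ℂ} (hu : u ≠ 0) (hv : v ≠ 0) (hw : w ≠ 0)
    (h : 2 * Real.pi < ccwAngle u v + ccwAngle v w) :
    ccwAngle u w = ccwAngle u v + ccwAngle v w - 2 * Real.pi := by
  obtain ⟨r, hr, h1⟩ := exists_eq_mul_exp_ccwAngle hu hv
  obtain ⟨s, hs, h2⟩ := exists_eq_mul_exp_ccwAngle hv hw
  refine ccwAngle_eq hu (mul_pos hs hr) (by linarith)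
    (by linarith [ccwAngle_le u v, ccwAngle_le v w]) ?_
  push_cast
  rw [sub_mul, add_mul, Complex.exp_sub, Complex.exp_two_pi_mul_I, div_one, Complex.exp_add]
  calc w = s * Complex.exp (ccwAngle v w * Complex.I) * v := h2
    _ = s * Complex.exp (ccwAngle v w * Complex.I) *
        (r * Complex.exp (ccwAngle u v * Complex.I) * u) := by rw [← h1]
    _ = _ := by ring

lemma ccwAngle_comm {u v : ℂ} (hu : u ≠ 0) (hv : v ≠ 0) (h : ccwAngle u v < 2 * Real.pi) :
    ccwAngle v u = 2 * Real.pi - ccwAngle u v := by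
  rcases le_or_gt (ccwAngle u v + ccwAngle v u) (2 * Real.pi) with h1 | h1
  · have := ccwAngle_add hu hv hu h1
    rw [ccwAngle_self hu] at this
    linarith
  · have := ccwAngle_add_sub hu hv hu h1
    rw [ccwAngle_self hu] at this
    linarith [ccwAngle_le v u]

/-- Directions at the points of `V` can be rotated to the next direction counterclockwise. -/
lemma exists_rotation {D V : Type*} [Finite D] (f : D → V) (u : D → ℂ) (hu : ∀ d, u d ≠ 0)
    (hne : ∀ d d', d ≠ d' → f d = f d' → ccwAngle (u d) (u d') < 2 * Real.pi) :
    ∃ σ : Equiv.Perm D, (∀ d, f (σ d) = f d) ∧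
      (∀ d d', f d' = f d → ccwAngle (u d) (u (σ d)) ≤ ccwAngle (u d) (u d')) ∧
      (∀ d d', σ d = d → f d' = f d → d' = d) ∧
      (∀ d d', σ (σ d) = d → f d' = f d → d' = d ∨ d' = σ d) := by
  have hex : ∀ d, ∃ e, f e = f d ∧
      ∀ d', f d' = f d → ccwAngle (u d) (u e) ≤ ccwAngle (u d) (u d') := fun d =>
    (Set.toFinite {e | f e = f d}).exists_minimalFor (fun e => ccwAngle (u d) (u e)) _ ⟨d, rfl⟩
      |>.imp fun e he => ⟨he.1, fun d' hd' => by
        rcases le_total (ccwAngle (u d) (u e)) (ccwAngle (u d) (u d')) with h | h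
        · exact h
        · exact he.2 hd' h⟩
  choose s hs hmin using hex
  -- If d ≠ e had the same successor, then turning from d to e and on to that successor would stay
  -- within one full turn, so e would come strictly before the successor of d.
  have hinj : Function.Injective s := by
    intro d e hde
    by_contra hne'
    have hf : f d = f e := by rw [← hs d, hde, hs e]
    have h1 := hne d e hne' hf
    have h2 := ccwAngle_comm (hu d) (hu e) h1
    have h3 := hmin d e hf.symm
    have h4 := hmin e d hf
    rw [← hde] at h4
    have h5 := ccwAngle_add (hu d) (hu e) (hu (s d)) (by linarith)
    linarith [ccwAngle_pos (u e) (u (s d))]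
  have hfix : ∀ d d', s d = d → f d' = f d → d' = d := by
    intro d d' hd hf
    by_contra hne'
    have h1 := hmin d d' hf
    rw [hd, ccwAngle_self (hu d)] at h1
    linarith [hne d d' (Ne.symm hne') hf.symm]
  refine ⟨Equiv.ofBijective s (Finite.injective_iff_bijective.1 hinj), hs, hmin, hfix, ?_⟩
  intro d d' hdd hf
  simp only [Equiv.ofBijective_apply] at hdd ⊢
  by_cases hsd : s d = d
  · exact Or.inl (hfix d d' hsd hf)
  by_contra! hcon
  -- The directions d and s d cut the full turn into two sectors, each empty by minimality, so a
  -- third direction has no place.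
  have h1 := hne d (s d) (Ne.symm hsd) (hs d).symm
  have h2 := ccwAngle_comm (hu d) (hu (s d)) h1
  have h3 := hmin d d' hf
  have h4 := hmin (s d) d' (hf.trans (hs d).symm)
  rw [hdd, h2] at h4
  have h5 := hne (s d) d' hcon.2.symm ((hs d).trans hf.symm)
  have h6 := hne d d' hcon.1.symm hf.symm
  rcases lt_or_ge (2 * Real.pi) (ccwAngle (u d) (u (s d)) + ccwAngle (u (s d)) (u d')) with h | h
  · have := ccwAngle_add_sub (hu d) (hu (s d)) (hu d') h
    linarith
  · have := ccwAngle_add (hu d) (hu (s d)) (hu d') h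
    linarith

/-- A full turn would make the directions positive multiples of each other, and the two segments
would share inner points near the common source. -/
lemma SegmentSystem.ccwAngle_lt {ι : Type*} (S : SegmentSystem ι) {o₁ o₂ : ι × Bool}
    (hne : o₁.1 ≠ o₂.1) (hsrc : S.src o₁ = S.src o₂) :
    ccwAngle (S.dir o₁) (S.dir o₂) < 2 * Real.pi := by
  refine lt_of_le_of_ne (ccwAngle_le _ _) fun h => ?_
  obtain ⟨r, hr, h1⟩ := exists_eq_mul_exp_ccwAngle (S.dir_ne_zero o₁) (S.dir_ne_zero o₂)
  rw [h] at h1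
  push_cast at h1
  rw [Complex.exp_two_pi_mul_I, mul_one] at h1
  have hm : 0 < min 1 r := lt_min one_pos hr
  have hlt : min 1 r / 2 < min 1 r := by linarith
  have h2 := S.add_smul_dir_mem o₁ (t := min 1 r / 2)
    ⟨by positivity, hlt.trans_le (min_le_left _ _)⟩
  have h3 := S.add_smul_dir_mem o₂ (t := min 1 r / 2 / r)
    ⟨by positivity, (div_lt_one hr).2 (hlt.trans_le (min_le_right _ _))⟩
  apply S.notMem_segment_of_mem_openSegment hne h2
  have hrc : (r : ℂ) ≠ 0 := by exact_mod_cast hr.ne'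
  convert openSegment_subset_segment _ _ _ h3 using 1
  rw [hsrc, h1]
  push_cast
  field_simp

/-! ### The dimension count behind Euler's formula -/

/-- The constant functions make the kernel nontrivial, which costs one dimension by rank-nullity. -/
lemma finrank_range_add_one_le {X Y : Type*} [Finite X] [Nonempty X]
    (T : (X → ℝ) →ₗ[ℝ] Y → ℝ) (hT : T (fun _ => 1) = 0) :
    Module.finrank ℝ (LinearMap.range T) + 1 ≤ Nat.card X := by
  have := Fintype.ofFinite X
  have h := T.finrank_range_add_finrank_ker
  rw [Module.finrank_fintype_fun_eq_card, ← Nat.card_eq_fintype_card] at h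
  have hpos : 0 < Module.finrank ℝ (LinearMap.ker T) := by
    apply Module.finrank_pos_iff_exists_ne_zero.2
    refine ⟨⟨_, hT⟩, fun h0 => ?_⟩
    have h1 := congrFun (congrArg Subtype.val h0) (Classical.arbitrary X)
    exact one_ne_zero h1
  omega

/-- If every circulation is a difference of potentials on faces, then there are as many faces as
Euler's formula says. -/
lemma card_add_two_le_of_circulation {V E F : Type*} [Finite V] [Finite E] [Finite F]
    [Nonempty V] [Nonempty F] (tail head : E → V) (left right : E → F)
    (h : ∀ z : E → ℝ, (∀ g : V → ℝ, ∑ᶠ e, z e * (g (head e) - g (tail e)) = 0) →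
      ∃ p : F → ℝ, ∀ e, p (left e) - p (right e) = z e) :
    Nat.card E + 2 ≤ Nat.card V + Nat.card F := by
  classical
  have := Fintype.ofFinite V
  have := Fintype.ofFinite E
  have := Fintype.ofFinite F
  let T : (F → ℝ) →ₗ[ℝ] E → ℝ :=
    { toFun := fun p e => p (left e) - p (right e)
      map_add' := fun p q => by ext e; simp; ring
      map_smul' := fun c p => by ext e; simp; ring }
  let δ : (V → ℝ) →ₗ[ℝ] E → ℝ :=
    { toFun := fun g e => g (head e) - g (tail e)
      map_add' := fun p q => by ext e; simp; ring
      map_smul' := fun c p => by ext e; simp; ring }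
  have hT := finrank_range_add_one_le T (by ext e; simp [T])
  have hδ := finrank_range_add_one_le δ (by ext e; simp [δ])
  -- A functional z that kills both ranges is a circulation because it kills the range of δ, so z =
  -- T p for some p. As it also kills the range of T, the sum of the squares of z is 0.
  have htop : LinearMap.range T ⊔ LinearMap.range δ = ⊤ := by
    by_contra hne
    obtain ⟨φ, hφ0, hφ⟩ := Submodule.exists_le_ker_of_lt_top _ (lt_top_iff_ne_top.2 hne)
    set z : E → ℝ := fun e => φ fun j => if e = j then 1 else 0 with hz
    have hφz : ∀ x, φ x = ∑ e, x e * z e := fun x => by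
      rw [LinearMap.pi_apply_eq_sum_univ φ x]
      simp [hz]
    obtain ⟨p, hp⟩ := h z fun g => by
      rw [finsum_eq_sum_of_fintype]
      have h1 : φ (δ g) = 0 := hφ (Submodule.mem_sup_right ⟨g, rfl⟩)
      rw [hφz] at h1
      rw [← h1]
      exact Finset.sum_congr rfl fun e _ => mul_comm _ _
    have h2 : φ (T p) = 0 := hφ (Submodule.mem_sup_left ⟨p, rfl⟩)
    have h3 : T p = z := funext hp
    rw [h3, hφz, Finset.sum_eq_zero_iff_of_nonneg fun e _ => mul_self_nonneg _] at h2
    apply hφ0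
    refine LinearMap.ext fun x => ?_
    rw [hφz, LinearMap.zero_apply]
    exact Finset.sum_eq_zero fun e he => by rw [mul_self_eq_zero.1 (h2 e he), mul_zero]
  have h1 := Submodule.finrank_add_le_finrank_add_finrank (LinearMap.range T) (LinearMap.range δ)
  rw [htop, finrank_top, Module.finrank_fintype_fun_eq_card, ← Nat.card_eq_fintype_card] at h1
  omega

end

section

open Filter Topology Set

/-! ### Polygonal drawings in the complex plane -/

/-- The first `n` segments of the polygonal path with corners `q 0, q 1, …` do not meet except
for common corners of consecutive ones. -/
structure IsSimplePath (n : ℕ) (q : ℕ → ℂ) : Prop where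
  ne : ∀ i, i < n → q i ≠ q (i + 1)
  inter_succ : ∀ i, i + 1 < n →
    segment ℝ (q i) (q (i + 1)) ∩ segment ℝ (q (i + 1)) (q (i + 2)) = {q (i + 1)}
  disjoint : ∀ i j, i + 1 < j → j < n →
    Disjoint (segment ℝ (q i) (q (i + 1))) (segment ℝ (q j) (q (j + 1)))

namespace IsSimplePath

variable {n : ℕ} {q : ℕ → ℂ} (h : IsSimplePath n q)

include h

lemma eq_or_eq_of_mem {k i : ℕ} (hk : k ≤ n) (hi : i < n)
    (hmem : q k ∈ segment ℝ (q i) (q (i + 1))) : k = i ∨ k = i + 1 := by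
  by_contra! hcon
  rcases lt_or_gt_of_ne hcon.1 with hlt | hgt
  · rcases Nat.lt_or_ge (k + 1) i with h1 | h1
    · exact disjoint_left.1 (h.disjoint k i h1 hi) (left_mem_segment _ _ _) hmem
    · obtain rfl : i = k + 1 := by omega
      have : q k ∈ ({q (k + 1)} : Set ℂ) := by
        rw [← h.inter_succ k hi]
        exact ⟨left_mem_segment _ _ _, hmem⟩
      exact h.ne k (by omega) this
  · obtain ⟨m, rfl⟩ : ∃ m, k = m + 1 := ⟨k - 1, by omega⟩
    rcases Nat.lt_or_ge (i + 1) m with h1 | h1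
    · exact disjoint_left.1 (h.disjoint i m h1 (by omega)) hmem (right_mem_segment _ _ _)
    · obtain rfl : m = i + 1 := by omega
      have : q (i + 1 + 1) ∈ ({q (i + 1)} : Set ℂ) := by
        rw [← h.inter_succ i (by omega)]
        exact ⟨hmem, right_mem_segment _ _ _⟩
      exact h.ne (i + 1) (by omega) this.symm

lemma injOn {k i : ℕ} (hk : k ≤ n) (hi : i ≤ n) (heq : q k = q i) : k = i := by
  wlog hki : k ≤ i generalizing k i
  · exact (this hi hk heq.symm (by omega)).symm
  rcases hki.eq_or_lt with rfl | hlt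
  · rfl
  · rcases h.eq_or_eq_of_mem hi (by omega : k < n) (heq ▸ left_mem_segment _ _ _) with h1 | h1
    · exact h1.symm
    · subst h1
      exact absurd heq (h.ne k (by omega))

lemma eq_endpoint_of_mem {i j : ℕ} (hi : i < n) (hj : j < n) (hij : i ≠ j) {z : ℂ}
    (hzi : z ∈ segment ℝ (q i) (q (i + 1))) (hzj : z ∈ segment ℝ (q j) (q (j + 1))) :
    z = q i ∨ z = q (i + 1) := by
  rcases lt_or_gt_of_ne hij with hlt | hgt
  · rcases Nat.lt_or_ge (i + 1) j with h1 | h1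
    · exact absurd hzj (disjoint_left.1 (h.disjoint i j h1 hj) hzi)
    · obtain rfl : j = i + 1 := by omega
      right
      have : z ∈ ({q (i + 1)} : Set ℂ) := by
        rw [← h.inter_succ i hj]
        exact ⟨hzi, hzj⟩
      exact this
  · rcases Nat.lt_or_ge (j + 1) i with h1 | h1
    · exact absurd hzi (disjoint_left.1 (h.disjoint j i h1 hi) hzj)
    · obtain rfl : i = j + 1 := by omega
      left
      have : z ∈ ({q (j + 1)} : Set ℂ) := by
        rw [← h.inter_succ j hi]
        exact ⟨hzj, hzi⟩
      exact this

end IsSimplePath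

namespace SimpleGraph

variable {V : Type*} {G : SimpleGraph V}

/-- A drawing of `G` in the complex plane with chosen polygonal paths for the edges. -/
structure PolygonalDrawing (G : SimpleGraph V) where
  pt : V → ℂ
  pt_injective : Function.Injective pt
  tail : G.edgeSet → V
  head : G.edgeSet → V
  eq_mk : ∀ e : G.edgeSet, (e : Sym2 V) = s(tail e, head e)
  n : G.edgeSet → ℕ
  pos : ∀ e, 0 < n e
  q : G.edgeSet → ℕ → ℂ
  q_zero : ∀ e, q e 0 = pt (tail e)
  q_n : ∀ e, q e (n e) = pt (head e)
  simple : ∀ e, IsSimplePath (n e) (q e)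
  vertex : ∀ (e : G.edgeSet) i v, i < n e → pt v ∈ segment ℝ (q e i) (q e (i + 1)) → v ∈ (e : Sym2 V)
  cross : ∀ e f : G.edgeSet, e ≠ f → ∀ i j, i < n e → j < n f → ∀ z ∈ segment ℝ (q e i) (q e (i + 1)),
    z ∈ segment ℝ (q f j) (q f (j + 1)) → ∃ v, v ∈ (e : Sym2 V) ∧ pt v = z

/-- The plane is identified with ℂ by a linear map, which preserves segments, and every edge gets an
arbitrary orientation. -/
lemma IsPlanar.nonempty_polygonalDrawing (h : G.IsPlanar) : Nonempty G.PolygonalDrawing := by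
  obtain ⟨D⟩ := h
  set φ : (ℝ × ℝ) ≃ₗ[ℝ] ℂ := Complex.equivRealProdLm.symm with hφ
  have hseg : ∀ x y z : ℝ × ℝ, φ z ∈ segment ℝ (φ x) (φ y) ↔ z ∈ segment ℝ x y := by
    intro x y z
    have := image_segment ℝ φ.toLinearMap.toAffineMap x y
    simp only [LinearMap.coe_toAffineMap, LinearEquiv.coe_coe] at this
    rw [← this]
    exact φ.injective.mem_set_image
  have hex : ∀ e : G.edgeSet, ∃ t h : V, (e : Sym2 V) = s(t, h) ∧
      IsPolygonalArc (D.arc e) (D.point t) (D.point h) := by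
    rintro ⟨e, he⟩
    induction e using Sym2.ind with
    | _ t h => exact ⟨t, h, rfl, D.isPolygonalArc_arc t h he⟩
  choose t h heq harc using hex
  choose n p hn hp0 hpn hA hne hsucc hdisj using harc
  have hmem : ∀ e i z, i < n e → z ∈ segment ℝ (p e i) (p e (i + 1)) → z ∈ D.arc e := by
    intro e i z hi hz
    rw [hA]
    exact mem_iUnion.2 ⟨⟨i, hi⟩, hz⟩
  refine ⟨⟨fun v => φ (D.point v), φ.injective.comp D.point_injective, t, h, heq, n, hn,
    fun e i => φ (p e i), fun e => by rw [hp0], fun e => by rw [hpn], fun e => ⟨?_, ?_, ?_⟩,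
    ?_, ?_⟩⟩
  · intro i hi
    exact φ.injective.ne (hne e i hi)
  · intro i hi
    ext z
    obtain ⟨z, rfl⟩ := φ.surjective z
    rw [mem_inter_iff, hseg, hseg, ← mem_inter_iff, hsucc e i hi, mem_singleton_iff,
      mem_singleton_iff, φ.injective.eq_iff]
  · intro i j hij hj
    rw [Set.disjoint_left]
    intro z
    obtain ⟨z, rfl⟩ := φ.surjective z
    rw [hseg, hseg]
    exact fun h1 h2 => Set.disjoint_left.1 (hdisj e i j hij hj) h1 h2
  · intro e i v hi hv
    exact D.mem_of_point_mem_arc e e.2 v (hmem e i _ hi ((hseg _ _ _).1 hv))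
  · intro e f hef i j hi hj z
    obtain ⟨z, rfl⟩ := φ.surjective z
    rw [hseg, hseg]
    intro h1 h2
    obtain ⟨v, hv, -, hvz⟩ := D.exists_of_mem_arc_inter e e.2 f f.2
      (fun h => hef (Subtype.ext h)) z ⟨hmem e i _ hi h1, hmem f j _ hj h2⟩
    exact ⟨v, hv, by rw [hvz]⟩

namespace PolygonalDrawing

variable (P : G.PolygonalDrawing)

lemma corner_of_pt_mem {e : G.edgeSet} {i : ℕ} {v : V} (hi : i < P.n e)
    (hv : P.pt v ∈ segment ℝ (P.q e i) (P.q e (i + 1))) :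
    P.pt v = P.q e i ∨ P.pt v = P.q e (i + 1) := by
  have h1 := P.vertex e i v hi hv
  rw [P.eq_mk, Sym2.mem_iff] at h1
  rcases h1 with rfl | rfl
  · rw [← P.q_zero] at hv ⊢
    exact ((P.simple e).eq_or_eq_of_mem (Nat.zero_le _) hi hv).imp (congrArg _) (congrArg _)
  · rw [← P.q_n] at hv ⊢
    exact ((P.simple e).eq_or_eq_of_mem le_rfl hi hv).imp (congrArg _) (congrArg _)

/-- The segments of a polygonal drawing. -/
def segmentSystem : SegmentSystem (Σ e : G.edgeSet, Fin (P.n e)) where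
  a i := P.q i.1 i.2
  b i := P.q i.1 (i.2 + 1)
  ne i := (P.simple i.1).ne i.2 i.2.2
  inter := by
    rintro ⟨e, i⟩ ⟨f, j⟩ hij z hz hz'
    by_cases hef : e = f
    · subst hef
      exact (P.simple e).eq_endpoint_of_mem i.2 j.2
        (fun h => hij (by rw [Fin.ext h])) hz hz'
    · obtain ⟨v, -, rfl⟩ := P.cross e f hef i j i.2 j.2 z hz hz'
      exact P.corner_of_pt_mem i.2 hz

open SegmentSystem

/-- The edge of a dart as an element of the edge set. -/
def dartEdge (d : G.Dart) : G.edgeSet := ⟨d.edge, d.edge_mem⟩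

open Classical in
/-- The first segment of the path belonging to a dart. -/
noncomputable def first (d : G.Dart) : (Σ e : G.edgeSet, Fin (P.n e)) × Bool :=
  if d.fst = P.tail (dartEdge d) then (⟨dartEdge d, ⟨0, P.pos _⟩⟩, true)
  else (⟨dartEdge d, ⟨P.n (dartEdge d) - 1, Nat.sub_lt (P.pos _) one_pos⟩⟩, false)

lemma tail_ne_head (e : G.edgeSet) : P.tail e ≠ P.head e := by
  have h := e.2
  rw [P.eq_mk, mem_edgeSet] at h
  exact h.ne

/-- The dart along the chosen orientation of an edge. -/
def forward (e : G.edgeSet) : G.Dart := ⟨(P.tail e, P.head e), by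
  have h := e.2
  rwa [P.eq_mk, mem_edgeSet] at h⟩

lemma dartEdge_forward (e : G.edgeSet) : dartEdge (P.forward e) = e :=
  Subtype.ext (P.eq_mk e).symm

lemma dartEdge_symm (d : G.Dart) : dartEdge d.symm = dartEdge d :=
  Subtype.ext d.edge_symm

lemma first_of_eq_tail {e : G.edgeSet} {d : G.Dart} (he : dartEdge d = e)
    (h : d.fst = P.tail e) : P.first d = (⟨e, ⟨0, P.pos _⟩⟩, true) := by
  subst he
  rw [first, if_pos h]

lemma first_of_eq_head {e : G.edgeSet} {d : G.Dart} (he : dartEdge d = e)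
    (h : d.fst = P.head e) :
    P.first d = (⟨e, ⟨P.n e - 1, Nat.sub_lt (P.pos _) one_pos⟩⟩, false) := by
  subst he
  rw [first, if_neg]
  rw [h]
  exact (P.tail_ne_head _).symm

lemma eq_forward_or (d : G.Dart) : d = P.forward (dartEdge d) ∨
    d = (P.forward (dartEdge d)).symm := by
  have h := congrArg Subtype.val (P.dartEdge_forward (dartEdge d))
  exact dart_edge_eq_iff _ _ |>.1 h.symm

lemma first_fst (d : G.Dart) : (P.first d).1.1 = dartEdge d := by
  rw [first]
  split_ifs <;> rfl

lemma first_forward (e : G.edgeSet) :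
    P.first (P.forward e) = (⟨e, ⟨0, P.pos _⟩⟩, true) :=
  P.first_of_eq_tail (P.dartEdge_forward e) rfl

lemma first_forward_symm (e : G.edgeSet) : P.first (P.forward e).symm =
    (⟨e, ⟨P.n e - 1, Nat.sub_lt (P.pos _) one_pos⟩⟩, false) :=
  P.first_of_eq_head (by rw [dartEdge_symm, dartEdge_forward]) rfl

lemma src_first (d : G.Dart) : P.segmentSystem.src (P.first d) = P.pt d.fst := by
  rcases P.eq_forward_or d with h | h
  · rw [h, first_forward]
    exact P.q_zero _
  · rw [h, first_forward_symm]
    show P.q _ (P.n _ - 1 + 1) = _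
    rw [Nat.sub_add_cancel (P.pos _)]
    exact P.q_n _

/-- At a vertex no segments start other than the first segments of darts there, so a successor among
darts is a successor among all oriented segments. -/
lemma exists_first_eq {o : (Σ e : G.edgeSet, Fin (P.n e)) × Bool} {v : V}
    (h : P.segmentSystem.src o = P.pt v) : ∃ d : G.Dart, d.fst = v ∧ P.first d = o := by
  have hv := P.segmentSystem.src_mem_segment o
  rw [h] at hv
  have hv' := P.vertex o.1.1 o.1.2 v o.1.2.2 hv
  rw [P.eq_mk, Sym2.mem_iff] at hv'
  rcases o with ⟨⟨e, i, hi⟩, _ | _⟩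
  · have h1 : P.q e (i + 1) = P.pt v := h
    rcases hv' with rfl | rfl
    · rw [← P.q_zero] at h1
      have := (P.simple e).injOn (by omega) (by omega) h1
      omega
    · refine ⟨(P.forward e).symm, rfl, ?_⟩
      rw [← P.q_n] at h1
      have := (P.simple e).injOn (by omega) le_rfl h1
      rw [first_forward_symm]
      simp only [Prod.mk.injEq, and_true]
      congr 2
      omega
  · have h1 : P.q e i = P.pt v := h
    rcases hv' with rfl | rfl
    · refine ⟨P.forward e, rfl, ?_⟩
      rw [← P.q_zero] at h1
      have := (P.simple e).injOn hi.le (by omega) h1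
      rw [first_forward]
      simp only [Prod.mk.injEq, and_true]
      congr 2
      omega
    · rw [← P.q_n] at h1
      have := (P.simple e).injOn hi.le le_rfl h1
      omega

lemma eq_of_fst_eq_of_dartEdge_eq {d d' : G.Dart} (h : d.fst = d'.fst)
    (he : dartEdge d = dartEdge d') : d = d' := by
  rcases (dart_edge_eq_iff _ _).1 (congrArg Subtype.val he) with h1 | h1
  · exact h1
  · subst h1
    exact absurd h d'.snd_ne_fst

lemma ccwAngle_first_lt {d d' : G.Dart} (hne : d ≠ d') (h : d.fst = d'.fst) :
    ccwAngle (P.segmentSystem.dir (P.first d)) (P.segmentSystem.dir (P.first d')) <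
      2 * Real.pi := by
  apply P.segmentSystem.ccwAngle_lt
  · intro he
    apply hne
    apply eq_of_fst_eq_of_dartEdge_eq h
    rw [← P.first_fst, ← P.first_fst, he]
  · rw [src_first, src_first, h]

/-- The values on the left of a polygonal path do not change at its corners. -/
lemma leftValue_rev_first {l : (Σ e : G.edgeSet, Fin (P.n e)) × Bool → ℝ}
    (hl : ∀ o₁ o₂, P.segmentSystem.src o₂ = P.segmentSystem.src o₁ →
      (∀ o₃, P.segmentSystem.src o₃ = P.segmentSystem.src o₁ →
        ccwAngle (P.segmentSystem.dir o₁) (P.segmentSystem.dir o₂) ≤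
          ccwAngle (P.segmentSystem.dir o₁) (P.segmentSystem.dir o₃)) → l o₁ = l (rev o₂))
    (d : G.Dart) : l (rev (P.first d)) = l (P.first d.symm) := by
  -- At an inner corner of a path only its two incident segments start, so each is the
  -- counterclockwise successor of the other and the values on both sides carry over.
  have hcorner : ∀ (e : G.edgeSet) (i : ℕ) (hi : i + 1 < P.n e)
      (o : (Σ e : G.edgeSet, Fin (P.n e)) × Bool), P.segmentSystem.src o = P.q e (i + 1) →
      o = (⟨e, ⟨i, by omega⟩⟩, false) ∨ o = (⟨e, ⟨i + 1, hi⟩⟩, true) := by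
    intro e i hi o ho
    have hmem := P.segmentSystem.src_mem_segment o
    rw [ho] at hmem
    rcases o with ⟨⟨f, j, hj⟩, b⟩
    by_cases hef : e = f
    · subst hef
      cases b with
      | false =>
        have h1 : P.q e (j + 1) = P.q e (i + 1) := ho
        obtain rfl : j = i := by
          have := (P.simple e).injOn (by omega) (by omega) h1
          omega
        exact Or.inl rfl
      | true =>
        have h1 : P.q e j = P.q e (i + 1) := ho
        obtain rfl : j = i + 1 := (P.simple e).injOn (by omega) (by omega) h1
        exact Or.inr rfl
    · obtain ⟨v, hv, hvq⟩ := P.cross e f hef i j (by omega) hj _ (right_mem_segment _ _ _) hmem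
      rw [P.eq_mk, Sym2.mem_iff] at hv
      rcases hv with rfl | rfl
      · rw [← P.q_zero] at hvq
        have := (P.simple e).injOn (by omega) (by omega) hvq
        omega
      · rw [← P.q_n] at hvq
        have := (P.simple e).injOn le_rfl (by omega) hvq
        omega
  have hstep : ∀ (e : G.edgeSet) (i : ℕ) (hi : i + 1 < P.n e) (b : Bool),
      l (⟨e, ⟨i, by omega⟩⟩, b) = l (⟨e, ⟨i + 1, hi⟩⟩, b) := by
    intro e i hi b
    set o₁ : (Σ e : G.edgeSet, Fin (P.n e)) × Bool := (⟨e, ⟨i, by omega⟩⟩, false) with ho₁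
    set o₂ : (Σ e : G.edgeSet, Fin (P.n e)) × Bool := (⟨e, ⟨i + 1, hi⟩⟩, true) with ho₂
    have hself : ∀ o o', ccwAngle (P.segmentSystem.dir o) (P.segmentSystem.dir o') ≤
        ccwAngle (P.segmentSystem.dir o) (P.segmentSystem.dir o) := fun o o' => by
      rw [ccwAngle_self (P.segmentSystem.dir_ne_zero o)]
      exact ccwAngle_le _ _
    cases b with
    | true =>
      refine (hl o₂ o₁ rfl fun o₃ ho₃ => ?_).symm
      rcases hcorner e i hi o₃ ho₃ with rfl | rfl
      · exact le_rfl
      · exact hself _ _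
    | false =>
      refine hl o₁ o₂ rfl fun o₃ ho₃ => ?_
      rcases hcorner e i hi o₃ ho₃ with rfl | rfl
      · exact hself _ _
      · exact le_rfl
  have hall : ∀ (e : G.edgeSet) (i : ℕ) (hi : i < P.n e) (b : Bool),
      l (⟨e, ⟨0, P.pos e⟩⟩, b) = l (⟨e, ⟨i, hi⟩⟩, b) := by
    intro e i hi b
    induction i with
    | zero => rfl
    | succ i ih => exact (ih (by omega)).trans (hstep e i hi b)
  rcases P.eq_forward_or d with h | h
  · rw [h, first_forward, first_forward_symm]
    exact hall _ _ _ _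
  · rw [h, Dart.symm_symm, first_forward, first_forward_symm]
    exact (hall _ _ _ _).symm

end PolygonalDrawing

/-! ### Euler's inequality for the face permutation -/

/-- The face permutation of a rotation. -/
def facePerm (σ : Equiv.Perm G.Dart) : Equiv.Perm G.Dart :=
  σ.trans (Function.Involutive.toPerm _ Dart.symm_involutive)

/-- A planar graph has a rotation at every vertex for which Euler's inequality holds. -/
theorem IsPlanar.exists_rotation [Finite V] (h : G.IsPlanar) :
    ∃ σ : Equiv.Perm G.Dart, (∀ d, (σ d).fst = d.fst) ∧
      (∀ d d' : G.Dart, σ d = d → d'.fst = d.fst → d' = d) ∧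
      (∀ d d' : G.Dart, σ (σ d) = d → d'.fst = d.fst → d' = d ∨ d' = σ d) ∧
      (Nonempty G.edgeSet → Nat.card G.edgeSet + 2 ≤ Nat.card V +
        Nat.card (Quotient (Equiv.Perm.SameCycle.setoid (facePerm σ)))) := by
  classical
  have := Fintype.ofFinite V
  obtain ⟨P⟩ := h.nonempty_polygonalDrawing
  obtain ⟨σ, hσ, hmin, hfix, htwo⟩ := _root_.exists_rotation (fun d : G.Dart => d.fst)
    (fun d => P.segmentSystem.dir (P.first d)) (fun d => P.segmentSystem.dir_ne_zero _)
    (fun d d' hne hf => P.ccwAngle_first_lt hne hf)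
  refine ⟨σ, hσ, hfix, htwo, fun ⟨e₀⟩ => ?_⟩
  have : Nonempty V := ⟨P.tail e₀⟩
  have : Nonempty (Quotient (Equiv.Perm.SameCycle.setoid (facePerm σ))) :=
    ⟨⟦P.forward e₀⟧⟩
  apply card_add_two_le_of_circulation P.tail P.head (fun e => ⟦P.forward e⟧)
    (fun e => ⟦(P.forward e).symm⟧)
  intro z hz
  have := Fintype.ofFinite G.edgeSet
  obtain ⟨l, hl1, hl2⟩ := P.segmentSystem.exists_leftValue
    -- All segments of an edge get its weight, divided by 2π to normalize the jump; end point
    -- differences telescope along each path, so a circulation on edges gives one on segments.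
    (w := fun i => z i.1 / (2 * Real.pi)) (by
      intro g
      rw [Fintype.sum_sigma]
      have h1 := hz fun v => g (P.pt v)
      rw [finsum_eq_sum_of_fintype] at h1
      have h2 : ∀ e : G.edgeSet, ∑ i : Fin (P.n e), z e / (2 * Real.pi) *
          (g (P.segmentSystem.b ⟨e, i⟩) - g (P.segmentSystem.a ⟨e, i⟩)) =
          z e * (g (P.pt (P.head e)) - g (P.pt (P.tail e))) / (2 * Real.pi) := by
        intro e
        rw [← Finset.mul_sum, ← P.q_n, ← P.q_zero, ← Finset.sum_range_sub (fun i => g (P.q e i)),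
          ← Fin.sum_univ_eq_sum_range (fun i => g (P.q e (i + 1)) - g (P.q e i))]
        exact div_mul_eq_mul_div _ _ _
      rw [Finset.sum_congr rfl fun e _ => h2 e, ← Finset.sum_div, h1, zero_div])
  have hrev := P.leftValue_rev_first hl2
  -- The value on the left of d is the value on the right of its successor σ d, which is the value
  -- on the left of the reversed dart. So it descends to face orbits.
  have hinv : ∀ d, l (P.first (facePerm σ d)) = l (P.first d) := by
    intro d
    show l (P.first (σ d).symm) = _
    rw [← hrev]
    refine (hl2 _ _ (by rw [P.src_first, P.src_first, hσ]) fun o₃ ho₃ => ?_).symm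
    rw [P.src_first] at ho₃
    obtain ⟨d', hd', rfl⟩ := P.exists_first_eq ho₃
    exact hmin d d' hd'
  refine ⟨Quotient.lift (fun d => l (P.first d)) ?_, fun e => ?_⟩
  · rintro d d' ⟨k, rfl⟩
    have hz : ∀ (k : ℤ) d, l (P.first ((facePerm σ ^ k) d)) = l (P.first d) := by
      intro k
      induction k with
      | zero => simp
      | succ i ih => intro d; rw [zpow_add_one, Equiv.Perm.mul_apply, ih, hinv]
      | pred i ih =>
        intro d
        rw [zpow_sub_one, Equiv.Perm.mul_apply, ih, ← hinv, Equiv.Perm.inv_def, Equiv.apply_symm_apply]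
    exact (hz k d).symm
  · show l (P.first (P.forward e)) - l (P.first (P.forward e).symm) = z e
    rw [← hrev, P.first_forward]
    have := hl1 ⟨e, ⟨0, P.pos e⟩⟩
    rw [mul_div_cancel₀ _ Real.two_pi_pos.ne'] at this
    exact this

end SimpleGraph

end

section

open Function

/-! ### Counting orbits -/

section Orbits

variable {D : Type*} [Finite D] (ψ : Equiv.Perm D)

lemma minimalPeriod_perm_pos (d : D) : 0 < minimalPeriod ψ d :=
  minimalPeriod_pos_of_mem_periodicPts (ψ.injective.mem_periodicPts d)

lemma minimalPeriod_perm_apply (d : D) : minimalPeriod ψ (ψ d) = minimalPeriod ψ d :=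
  minimalPeriod_apply (ψ.injective.mem_periodicPts d)

lemma minimalPeriod_eq_of_sameCycle {d d' : D} (h : ψ.SameCycle d d') :
    minimalPeriod ψ d = minimalPeriod ψ d' := by
  obtain ⟨k, -, rfl⟩ := h.exists_pow_eq'
  clear h
  induction k with
  | zero => rfl
  | succ k ih =>
    rw [pow_succ', Equiv.Perm.mul_apply, minimalPeriod_perm_apply]
    exact ih

/-- The number of orbits is at most the sum of the reciprocal lengths of the orbits. -/
lemma card_quotient_sameCycle_le [Fintype D] :
    (Nat.card (Quotient (Equiv.Perm.SameCycle.setoid ψ)) : ℚ) ≤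
      ∑ d, 1 / (minimalPeriod ψ d : ℚ) := by
  classical
  have := Fintype.ofFinite (Quotient (Equiv.Perm.SameCycle.setoid ψ))
  rw [Nat.card_eq_fintype_card, ← Finset.card_univ, Finset.card_eq_sum_ones, Nat.cast_sum,
    ← Finset.sum_fiberwise Finset.univ
      (fun d => (⟦d⟧ : Quotient (Equiv.Perm.SameCycle.setoid ψ)))]
  refine Finset.sum_le_sum fun x _ => ?_
  obtain ⟨d, rfl⟩ := Quotient.exists_rep x
  set A := Finset.univ.filter fun e =>
    (⟦e⟧ : Quotient (Equiv.Perm.SameCycle.setoid ψ)) = ⟦d⟧ with hA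
  have hpos := minimalPeriod_perm_pos ψ d
  have h1 : ∑ e ∈ A, 1 / (minimalPeriod ψ e : ℚ) = A.card * (1 / (minimalPeriod ψ d : ℚ)) := by
    rw [← nsmul_eq_mul, ← Finset.sum_const]
    refine Finset.sum_congr rfl fun e he => ?_
    rw [minimalPeriod_eq_of_sameCycle ψ (Quotient.exact (Finset.mem_filter.1 he).2)]
  have h2 : minimalPeriod ψ d ≤ A.card := by
    rw [← Finset.card_range (minimalPeriod ψ d)]
    apply Finset.card_le_card_of_injOn (fun k => ψ^[k] d)
    · intro k _
      simp only [hA, Finset.coe_filter, Finset.mem_univ, true_and, Set.mem_ofPred_eq]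
      apply Quotient.sound
      show ψ.SameCycle _ _
      rw [← Equiv.Perm.coe_pow]
      exact (Equiv.Perm.sameCycle_pow_left).2 (Equiv.Perm.SameCycle.refl _ _)
    · intro i hi j hj hij
      exact iterate_injOn_Iio_minimalPeriod (by simpa using hi) (by simpa using hj) hij
  rw [h1, mul_one_div, Nat.cast_one, le_div_iff₀ (by exact_mod_cast hpos), one_mul]
  exact_mod_cast h2

/-- The discharging argument: faces of length three receive charge from faces of length at least
five across at least two of their sides, while no two consecutive sides of a face border faces of
length three. -/
lemma four_mul_card_quotient_le (τ : D → D) (hτ : Involutive τ)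
    (h3 : ∀ d, 3 ≤ minimalPeriod ψ d)
    (hsep : ∀ d, minimalPeriod ψ (τ d) = 3 → minimalPeriod ψ (τ (ψ d)) ≠ 3)
    (htri : ∀ d, minimalPeriod ψ d = 3 →
      5 ≤ minimalPeriod ψ (τ d) ∨ 5 ≤ minimalPeriod ψ (τ (ψ d))) :
    4 * Nat.card (Quotient (Equiv.Perm.SameCycle.setoid ψ)) ≤ Nat.card D := by
  classical
  have := Fintype.ofFinite D
  set l : D → ℕ := minimalPeriod ψ with hl
  have hlψ : ∀ d, l (ψ d) = l d := minimalPeriod_perm_apply ψ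
  have hit : ∀ d, ψ^[l d] d = d := fun d => iterate_minimalPeriod
  have hψ : ∀ f : D → ℚ, ∑ d, f (ψ d) = ∑ d, f d := fun f => Equiv.sum_comp ψ f
  -- Indicators on darts: `a` marks sides of triangular faces across which a face of length at least
  -- five lies, `b₅` and `b₆` mark the same sides seen from the long face, and `n₃`, `n₅`, `n₆`
  -- record the face length.
  set a : D → ℚ := fun d => if l d = 3 ∧ 5 ≤ l (τ d) then 1 else 0 with ha
  set b₅ : D → ℚ := fun d => if l (τ d) = 3 ∧ l d = 5 then 1 else 0 with hb₅
  set b₆ : D → ℚ := fun d => if l (τ d) = 3 ∧ 6 ≤ l d then 1 else 0 with hb₆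
  set n₃ : D → ℚ := fun d => if l d = 3 then 1 else 0 with hn₃
  set n₅ : D → ℚ := fun d => if l d = 5 then 1 else 0 with hn₅
  set n₆ : D → ℚ := fun d => if 6 ≤ l d then 1 else 0 with hn₆
  have e1 : 2 * ∑ d, n₃ d ≤ 3 * ∑ d, a d := by
    have h1 : ∀ d, 2 * n₃ d ≤ a d + a (ψ d) + a (ψ (ψ d)) := by
      intro d
      -- Among any two consecutive sides one is good, so at most one of the three sides fails.
      by_cases hd : l d = 3
      · have p0 := htri d hd
        have p1 := htri (ψ d) ((hlψ _).trans hd)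
        have p2 := htri (ψ (ψ d)) (((hlψ _).trans (hlψ _)).trans hd)
        have h0 := hit d
        rw [hd] at h0
        have h0' : ψ (ψ (ψ d)) = d := h0
        rw [h0'] at p2
        simp only [ha, hn₃, hlψ, hd, true_and, if_true]
        split_ifs <;> first | (norm_num; done) | (exfalso; tauto)
      · simp [ha, hn₃, hlψ, hd]
    have h2 := Finset.sum_le_sum fun d (_ : d ∈ Finset.univ) => h1 d
    rw [← Finset.mul_sum, Finset.sum_add_distrib, Finset.sum_add_distrib, hψ a,
      hψ fun d => a (ψ d), hψ a] at h2
    linarith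
  have e2 : ∑ d, a d = ∑ d, b₅ d + ∑ d, b₆ d := by
    rw [← Equiv.sum_comp hτ.toPerm a, ← Finset.sum_add_distrib]
    refine Finset.sum_congr rfl fun d _ => ?_
    simp only [ha, hb₅, hb₆, Involutive.coe_toPerm, hτ d]
    by_cases q : l (τ d) = 3
    · simp only [q, true_and]
      split_ifs <;> first | (norm_num; done) | omega
    · simp [q]
  have e3 : 5 * ∑ d, b₅ d ≤ 2 * ∑ d, n₅ d := by
    have h1 : ∀ d, b₅ d + b₅ (ψ d) + b₅ (ψ (ψ d)) + b₅ (ψ (ψ (ψ d))) +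
        b₅ (ψ (ψ (ψ (ψ d)))) ≤ 2 * n₅ d := by
      intro d
      -- Of five sides in cyclic order, at most two can be chosen without consecutive ones.
      by_cases hd : l d = 5
      · have p0 := hsep d
        have p1 := hsep (ψ d)
        have p2 := hsep (ψ (ψ d))
        have p3 := hsep (ψ (ψ (ψ d)))
        have p4 := hsep (ψ (ψ (ψ (ψ d))))
        have h0 := hit d
        rw [hd] at h0
        have h0' : ψ (ψ (ψ (ψ (ψ d)))) = d := h0
        rw [h0'] at p4
        simp only [hb₅, hn₅, hlψ, hd, and_true, if_true]
        generalize l (τ d) = x0 at *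
        generalize l (τ (ψ d)) = x1 at *
        generalize l (τ (ψ (ψ d))) = x2 at *
        generalize l (τ (ψ (ψ (ψ d)))) = x3 at *
        generalize l (τ (ψ (ψ (ψ (ψ d))))) = x4 at *
        split_ifs <;> first | (norm_num; done) | (exfalso; tauto)
      · simp [hb₅, hn₅, hlψ, hd]
    have h2 := Finset.sum_le_sum fun d (_ : d ∈ Finset.univ) => h1 d
    rw [← Finset.mul_sum] at h2
    simp only [Finset.sum_add_distrib] at h2
    rw [hψ fun d => b₅ (ψ (ψ (ψ d))), hψ fun d => b₅ (ψ (ψ d)), hψ fun d => b₅ (ψ d),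
      hψ b₅] at h2
    linarith
  have e4 : 2 * ∑ d, b₆ d ≤ ∑ d, n₆ d := by
    have h1 : ∀ d, b₆ d + b₆ (ψ d) ≤ n₆ d := by
      intro d
      have p0 := hsep d
      simp only [hb₆, hn₆, hlψ]
      split_ifs <;> first | (norm_num; done) | (exfalso; tauto)
    have h2 := Finset.sum_le_sum fun d (_ : d ∈ Finset.univ) => h1 d
    rw [Finset.sum_add_distrib, hψ b₆] at h2
    linarith
  -- The deviations of 1/3, 1/5, 1/6 from 1/4 are 1/12, -1/20, -1/12. At a charge of 1/8 per marked
  -- side, triangular faces are paid by `e1`, faces of length five break even by `e3`, and longer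
  -- faces have a surplus by `e4`.
  have e5 : ∑ d, 1 / (l d : ℚ) ≤
      ∑ d, (1 / 4 + n₃ d / 12 - n₅ d / 20 - n₆ d / 12) := by
    refine Finset.sum_le_sum fun d _ => ?_
    have := h3 d
    simp only [hn₃, hn₅, hn₆]
    rcases (by omega : l d = 3 ∨ l d = 4 ∨ l d = 5 ∨ 6 ≤ l d) with h | h | h | h
    · norm_num [h]
    · norm_num [h]
    · norm_num [h]
    · rw [if_neg (by omega), if_neg (by omega), if_pos h]
      have h6 : (6 : ℚ) ≤ l d := by exact_mod_cast h
      rw [div_le_iff₀ (by linarith)]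
      linarith
  have e6 : _ ≤ ∑ d, 1 / (l d : ℚ) := card_quotient_sameCycle_le ψ
  rw [Finset.sum_sub_distrib, Finset.sum_sub_distrib, Finset.sum_add_distrib, ← Finset.sum_div,
    ← Finset.sum_div, ← Finset.sum_div, ← Finset.sum_div, Finset.sum_const, Finset.card_univ, nsmul_eq_mul,
    ← Nat.card_eq_fintype_card] at e5
  have e7 : 0 ≤ ∑ d, b₆ d := Finset.sum_nonneg fun d _ => by
    simp only [hb₆]
    split_ifs <;> norm_num
  have e8 : (4 : ℚ) * Nat.card (Quotient (Equiv.Perm.SameCycle.setoid ψ)) ≤ Nat.card D := by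
    linarith
  exact_mod_cast e8

end Orbits

/-! ### Faces of graphs with disjoint triangles -/

namespace SimpleGraph

variable {V : Type*}

/-- Any triangle at a vertex has the same vertices as any other one there. -/
def TrianglesDisjoint (G : SimpleGraph V) : Prop :=
  ∀ a b c b' c', G.Adj a b → G.Adj b c → G.Adj c a → G.Adj a b' → G.Adj b' c' → G.Adj c' a →
    b' = b ∨ b' = c

/-- No two edges of a triangle lie on `4`-cycles. -/
def TriangleFourCycleSparse (G : SimpleGraph V) : Prop :=
  ∀ a b c p q r s, G.Adj a b → G.Adj b c → G.Adj c a →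
    G.Adj b p → G.Adj p q → G.Adj q a → a ≠ p → b ≠ q →
    G.Adj c r → G.Adj r s → G.Adj s b → b ≠ r → c ≠ s → False

variable {G : SimpleGraph V}

/-- The bound on the number of faces of a rotation for minimum degree three. -/
lemma four_mul_card_faces_le [Finite V] (h₁ : G.TrianglesDisjoint)
    (h₂ : G.TriangleFourCycleSparse) (σ : Equiv.Perm G.Dart) (hσ : ∀ d, (σ d).fst = d.fst)
    (hne : ∀ d, σ d ≠ d) (hne₂ : ∀ d, σ (σ d) ≠ d) :
    4 * Nat.card (Quotient (Equiv.Perm.SameCycle.setoid (facePerm σ))) ≤ Nat.card G.Dart := by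
  classical
  have := Fintype.ofFinite V
  set ψ := facePerm σ with hψdef
  have hψ : ∀ d, ψ d = (σ d).symm := fun d => rfl
  have hψσ : ∀ d, (ψ d).symm = σ d := fun d => Dart.symm_symm _
  -- Faces are walked backwards: `ψ d` ends where d starts.
  have hsnd : ∀ d, (ψ d).snd = d.fst := hσ
  have hext : ∀ d e : G.Dart, d.fst = e.fst → d.snd = e.snd → d = e := fun d e h h' =>
    Dart.ext _ _ (Prod.ext h h')
  have hback : ∀ d, (ψ d).fst ≠ d.snd := fun d h => hne d (hext _ _ (hσ d) h)
  have hge : ∀ d, 3 ≤ minimalPeriod ψ d := by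
    intro d
    have hpos := minimalPeriod_perm_pos ψ d
    have h := iterate_minimalPeriod (f := ψ) (x := d)
    by_contra hlt
    rcases (by omega : minimalPeriod ψ d = 1 ∨ minimalPeriod ψ d = 2) with h1 | h1
    · rw [h1] at h
      have h' : ψ d = d := h
      have h2 := hsnd d
      rw [h'] at h2
      exact d.snd_ne_fst h2
    · rw [h1] at h
      have h' : ψ (ψ d) = d := h
      have h2 := hsnd (ψ d)
      rw [h'] at h2
      exact hback d h2.symm
  have hlen3 : ∀ d, minimalPeriod ψ d = 3 → G.Adj d.snd (ψ d).fst := by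
    intro d hd
    have h := iterate_minimalPeriod (f := ψ) (x := d)
    rw [hd] at h
    have h' : ψ (ψ (ψ d)) = d := h
    have h1 := (ψ (ψ d)).adj
    rw [hsnd] at h1
    rw [← hsnd (ψ (ψ d)), h'] at h1
    exact h1
  have hlen4 : ∀ d, minimalPeriod ψ d = 4 → ∃ y z, G.Adj y d.fst ∧ G.Adj z y ∧ G.Adj d.snd z ∧
      y ≠ d.snd ∧ z ≠ d.fst := by
    intro d hd
    have h := iterate_minimalPeriod (f := ψ) (x := d)
    rw [hd] at h
    have h' : ψ (ψ (ψ (ψ d))) = d := h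
    refine ⟨(ψ d).fst, (ψ (ψ d)).fst, ?_, ?_, ?_, hback d, ?_⟩
    · have := (ψ d).adj
      rwa [hsnd] at this
    · have := (ψ (ψ d)).adj
      rwa [hsnd] at this
    · have := (ψ (ψ (ψ d))).adj
      rwa [hsnd, ← hsnd (ψ (ψ (ψ d))), h'] at this
    · have := hback (ψ d)
      rwa [hsnd] at this
  -- Triangular faces on both sides of an edge have the same third vertex; then the rotation at
  -- `d.snd` alternates between two darts, which `hne₂` forbids.
  have hopp : ∀ d, minimalPeriod ψ d = 3 → minimalPeriod ψ d.symm ≠ 3 := by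
    intro d hd hd'
    have t1 := hlen3 d hd
    have t2 := (ψ d).adj
    rw [hsnd] at t2
    have s1 := hlen3 _ hd'
    have s2 := (ψ d.symm).adj
    rw [hsnd] at s2
    have hy : (ψ d.symm).fst ≠ d.fst := hback d.symm
    rcases h₁ d.snd d.fst (ψ d).fst (ψ d.symm).fst d.fst d.adj.symm t2.symm t1.symm s2.symm s1.symm
      d.adj with h | h
    · exact hy h
    · have h' := iterate_minimalPeriod (f := ψ) (x := d)
      rw [hd] at h'
      have h3 : ψ (ψ (ψ d)) = d := h'
      have hs : σ (ψ (ψ d)) = d.symm := by rw [← hψσ, h3]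
      have hs2 : σ d.symm = ψ (ψ d) := by
        apply hext
        · rw [hσ, ← hsnd (ψ (ψ d)), h3]
          rfl
        · rw [hsnd, ← h]
          rfl
      exact hne₂ (ψ (ψ d)) (by rw [hs, hs2])
  apply four_mul_card_quotient_le ψ Dart.symm Dart.symm_involutive
  · exact hge
  -- Triangular faces across consecutive sides share a vertex, so they are the same triangle. Then σ
  -- returns to d after two steps at `d.fst`.
  · intro d hd hd'
    rw [hψσ] at hd'
    have t1 := hlen3 _ hd
    have t2 := (ψ d.symm).adj
    rw [hsnd] at t2
    have s1 := hlen3 _ hd'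
    have s2 := (ψ (σ d)).adj
    rw [hsnd, hσ] at s2
    have s3 := (σ d).adj
    rw [hσ] at s3
    rcases h₁ d.fst (σ d).snd (ψ (σ d)).fst d.snd (ψ d.symm).fst s3 s1 s2 d.adj t2.symm t1.symm
      with h | h
    · exact hback d h.symm
    · exact hne₂ d (hext _ _ (by rw [hσ, hσ]) h.symm)
  · intro d hd
    -- Otherwise the faces across two sides of the triangle have length exactly four, and both sides
    -- lie on 4-cycles.
    by_contra! hcon
    have hd' : minimalPeriod ψ (ψ d) = 3 := (minimalPeriod_perm_apply ψ d).trans hd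
    have g1 := hge d.symm
    have g2 := hge (ψ d).symm
    have o1 := hopp _ hd
    have o2 := hopp _ hd'
    obtain ⟨y, z, f1, f2, f3, f4, f5⟩ := hlen4 d.symm (by omega)
    obtain ⟨y', z', k1, k2, k3, k4, k5⟩ := hlen4 (ψ d).symm (by omega)
    have t1 := hlen3 d hd
    have t2 := (ψ d).adj
    rw [hsnd] at t2
    have hfst : (ψ d).symm.fst = d.fst := hsnd d
    rw [hfst] at k1 k5
    exact h₂ d.snd d.fst (ψ d).fst z y z' y' d.adj.symm t2.symm t1.symm f3 f2 f1 f5.symm f4.symm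
      k3 k2 k1 k5.symm k4.symm

end SimpleGraph

end

namespace SimpleGraph

variable {V : Type*} {G : SimpleGraph V}

/-! ### Sparsity -/

lemma IsPlanar.induce (h : G.IsPlanar) (s : Set V) : (G.induce s).IsPlanar := by
  obtain ⟨D⟩ := h
  have hmap : ∀ e ∈ (G.induce s).edgeSet, e.map Subtype.val ∈ G.edgeSet := by
    intro e he
    induction e using Sym2.ind with
    | _ u v => exact he
  refine ⟨⟨fun v => D.point v, fun e => D.arc (e.map Subtype.val),
    D.point_injective.comp Subtype.val_injective, ?_, ?_, ?_⟩⟩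
  · intro u v huv
    exact D.isPolygonalArc_arc u v huv
  · intro e he v hv
    obtain ⟨w, hw, hwv⟩ := Sym2.mem_map.1 (D.mem_of_point_mem_arc _ (hmap e he) v hv)
    rwa [← Subtype.ext hwv]
  · intro e he f hf hef z hz
    obtain ⟨v, hve, hvf, hvz⟩ := D.exists_of_mem_arc_inter _ (hmap e he) _ (hmap f hf)
      (fun h => hef (Sym2.map.injective Subtype.val_injective h)) z hz
    obtain ⟨w, hw, rfl⟩ := Sym2.mem_map.1 hve
    obtain ⟨w', hw', hww'⟩ := Sym2.mem_map.1 hvf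
    rw [Subtype.ext hww'] at hw'
    exact ⟨w, hw, hw', hvz⟩

lemma TrianglesDisjoint.induce (h : G.TrianglesDisjoint) (s : Set V) :
    (G.induce s).TrianglesDisjoint := by
  intro a b c b' c' h1 h2 h3 h4 h5 h6
  exact (h a b c b' c' h1 h2 h3 h4 h5 h6).imp Subtype.ext Subtype.ext

lemma TriangleFourCycleSparse.induce (h : G.TriangleFourCycleSparse) (s : Set V) :
    (G.induce s).TriangleFourCycleSparse := by
  intro a b c p q r t h1 h2 h3 h4 h5 h6 h7 h8 h9 h10 h11 h12 h13
  exact h a b c p q r t h1 h2 h3 h4 h5 h6 (fun h => h7 (Subtype.ext h))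
    (fun h => h8 (Subtype.ext h)) h9 h10 h11 (fun h => h12 (Subtype.ext h))
    (fun h => h13 (Subtype.ext h))

/-- If the degrees are at least three, there are at most twice as many edges as vertices. -/
lemma card_edgeSet_le_of_three_le_degree [Fintype V] [DecidableRel G.Adj] (hG : G.IsPlanar)
    (h₁ : G.TrianglesDisjoint) (h₂ : G.TriangleFourCycleSparse) (hdeg : ∀ v, 3 ≤ G.degree v) :
    Nat.card G.edgeSet ≤ 2 * Nat.card V := by
  classical
  rcases isEmpty_or_nonempty G.edgeSet with hempty | hnonempty
  · simp
  obtain ⟨σ, hσ, hfix, htwo, heuler⟩ := hG.exists_rotation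
  have hcard : ∀ (d : G.Dart) (t : Finset G.Dart), (∀ d' : G.Dart, d'.fst = d.fst → d' ∈ t) →
      3 ≤ t.card := by
    intro d t ht
    refine (hdeg d.fst).trans ?_
    rw [← G.dart_fst_fiber_card_eq_degree d.fst]
    apply Finset.card_le_card
    intro d' hd'
    exact ht d' (Finset.mem_filter.1 hd').2
  have hne : ∀ d, σ d ≠ d := by
    intro d hd
    have := hcard d {d} fun d' hd' => Finset.mem_singleton.2 (hfix d d' hd hd')
    simp at this
  have hne₂ : ∀ d, σ (σ d) ≠ d := by
    intro d hd
    have := hcard d {d, σ d} fun d' hd' => by simpa using htwo d d' hd hd'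
    have := (Finset.card_le_two (a := d) (b := σ d))
    omega
  have hfaces := four_mul_card_faces_le h₁ h₂ σ hσ hne hne₂
  have hedges := G.dart_card_eq_twice_card_edges
  have := heuler hnonempty
  rw [← Nat.card_eq_fintype_card, ← coe_edgeFinset, Nat.card_coe_set_eq, Set.ncard_coe_finset] at *
  -- There are 2E darts, so 4F ≤ 2E; with E + 2 ≤ V + F this bounds E by 2V - 4.
  omega

/-- Removing a vertex of degree at most two loses at most two edges, while the bound drops by two;
all hypotheses pass to induced subgraphs. -/
lemma card_edgeSet_le [Finite V] (hG : G.IsPlanar) (h₁ : G.TrianglesDisjoint)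
    (h₂ : G.TriangleFourCycleSparse) : Nat.card G.edgeSet ≤ 2 * Nat.card V := by
  classical
  induction hn : Nat.card V using Nat.strong_induction_on generalizing V with
  | _ n ih =>
    subst hn
    have := Fintype.ofFinite V
    by_cases hdeg : ∀ v, 3 ≤ G.degree v
    · exact card_edgeSet_le_of_three_le_degree hG h₁ h₂ hdeg
    · push Not at hdeg
      obtain ⟨v, hv⟩ := hdeg
      have hcard : Nat.card ({v}ᶜ : Set V) + 1 = Nat.card V := by
        rw [Nat.card_coe_set_eq, add_comm, ← Set.ncard_singleton v, Set.ncard_add_ncard_compl]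
      have h3 := ih _ (by omega) (hG.induce {v}ᶜ) (h₁.induce _) (h₂.induce _) rfl
      have h4 := G.card_edgeFinset_induce_compl_singleton v
      rw [G.card_edgeFinset_deleteIncidenceSet v] at h4
      have h5 := G.degree_le_card_edgeFinset v
      simp only [Nat.card_eq_fintype_card, ← edgeFinset_card] at *
      omega

/-! ### From sparsity to colorings -/

/-- A graph whose induced subgraphs have at most twice as many edges as vertices has an
orientation with out-degrees at most two: the edges leaving a vertex carry different marks
`0, 1`. -/
lemma exists_injective_of_card_edgeSet_le [Finite V]
    (h : ∀ s : Set V, Nat.card (G.induce s).edgeSet ≤ 2 * Nat.card s) :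
    ∃ f : G.edgeSet → V × Fin 2, Function.Injective f ∧ ∀ e : G.edgeSet, (f e).1 ∈ (e : Sym2 V) := by
  classical
  have := Fintype.ofFinite V
  suffices hall : ∀ A : Finset G.edgeSet, A.card ≤ (A.biUnion fun e : G.edgeSet =>
      Finset.univ.filter fun x : V × Fin 2 => x.1 ∈ (e : Sym2 V)).card by
    obtain ⟨f, hf, hf'⟩ := (Finset.all_card_le_biUnion_card_iff_exists_injective _).1 hall
    exact ⟨f, hf, fun e => (Finset.mem_filter.1 (hf' e)).2⟩
  intro A
  -- Hall's condition: the edges in A all lie in the subgraph induced on the set S of their ends,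
  -- and their available targets are the two marks at each vertex of S.
  set S : Finset V := Finset.univ.filter fun v => ∃ e ∈ A, v ∈ (e : Sym2 V) with hS
  have h1 : (A.biUnion fun e : G.edgeSet =>
      Finset.univ.filter fun x : V × Fin 2 => x.1 ∈ (e : Sym2 V)) = S ×ˢ Finset.univ := by
    ext x
    simp [hS]
  rw [h1, Finset.card_product, Finset.card_univ, Fintype.card_fin, mul_comm]
  have h2 := h S
  rw [Nat.card_eq_fintype_card, ← edgeFinset_card, Nat.card_coe_set_eq,
    Set.ncard_coe_finset] at h2
  refine le_trans ?_ h2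
  rw [← Finset.card_image_of_injective A Subtype.val_injective,
    ← Finset.card_image_of_injective _ (Sym2.map.injective Subtype.val_injective)]
  apply Finset.card_le_card
  intro e he
  obtain ⟨⟨e, he'⟩, heA, rfl⟩ := Finset.mem_image.1 he
  induction e using Sym2.ind with
  | _ u v =>
    have hu : u ∈ S := by
      rw [hS, Finset.mem_filter]
      exact ⟨Finset.mem_univ _, _, heA, Sym2.mem_mk_left _ _⟩
    have hv : v ∈ S := by
      rw [hS, Finset.mem_filter]
      exact ⟨Finset.mem_univ _, _, heA, Sym2.mem_mk_right _ _⟩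
    refine Finset.mem_image.2 ⟨s(⟨u, hu⟩, ⟨v, hv⟩), ?_, rfl⟩
    rw [mem_edgeFinset]
    exact he'

/-- The end to which f assigns an edge guards it by avoiding the color of that edge. A vertex guards
at most two edges, so three colors leave a choice. -/
lemma AdaptablyChoosable.of_injective [Finite V] {f : G.edgeSet → V × Fin 2}
    (hf : Function.Injective f) (hmem : ∀ e : G.edgeSet, (f e).1 ∈ (e : Sym2 V)) :
    G.AdaptablyChoosable 3 := by
  classical
  intro F L hL
  have := Fintype.ofFinite V
  set B : V → Finset ℤ := fun v =>
    (Finset.univ.filter fun e : G.edgeSet => (f e).1 = v).image F with hB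
  have hcard : ∀ v, (B v).card ≤ 2 := by
    intro v
    refine Finset.card_image_le.trans ?_
    refine le_trans ?_ (Finset.card_fin 2).le
    apply Finset.card_le_card_of_injOn (fun e => (f e).2) (fun _ _ => Finset.mem_univ _)
    intro e he e' he' hee'
    simp only [Finset.coe_filter, Finset.mem_univ, true_and, Set.mem_ofPred_eq] at he he'
    exact hf (Prod.ext (he.trans he'.symm) hee')
  have hex : ∀ v, ∃ k ∈ L v, k ∉ B v := fun v =>
    Finset.exists_mem_notMem_of_card_lt_card
      ((hcard v).trans_lt (lt_of_lt_of_le (by norm_num) (hL v)))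
  choose c hc hcB using hex
  refine ⟨c, fun u v huv => ?_, hc⟩
  have hF : ∀ w, (f ⟨s(u, v), huv⟩).1 = w → c w ≠ F ⟨s(u, v), huv⟩ := by
    intro w hw hcw
    apply hcB w
    rw [hcw]
    exact Finset.mem_image_of_mem _ (Finset.mem_filter.2 ⟨Finset.mem_univ _, hw⟩)
  rcases Sym2.mem_iff.1 (hmem ⟨s(u, v), huv⟩) with h | h
  · by_cases hcuv : c u = c v
    · exact Or.inr (hcuv ▸ hF u h)
    · exact Or.inl hcuv
  · exact Or.inr (hF v h)

/-- Color every edge with the one color its end lists may share. A monochromatic edge would have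
that color on both ends, against adaptedness. -/
lemma AdaptablyChoosable.separatedChoosable {k : ℕ} (h : G.AdaptablyChoosable k) :
    G.SeparatedChoosable k 1 := by
  intro L hL hsep
  have hex : ∀ e : G.edgeSet, ∃ m : ℤ, ∀ u v, (e : Sym2 V) = s(u, v) →
      ∀ x, x ∈ L u → x ∈ L v → x = m := by
    rintro ⟨e, he⟩
    induction e using Sym2.ind with
    | _ a b =>
      have hone : ∀ x y, x ∈ L a ∩ L b → y ∈ L a ∩ L b → x = y := fun x y hx hy =>
        Finset.card_le_one.1 (hsep a b he) x hx y hy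
      have key : ∃ m : ℤ, ∀ x, x ∈ L a → x ∈ L b → x = m := by
        rcases (L a ∩ L b).eq_empty_or_nonempty with h0 | ⟨m, hm⟩
        -- Disjoint lists: the edge is never monochromatic, and 0 is a dummy color.
        · refine ⟨0, fun x hxa hxb => ?_⟩
          have : x ∈ L a ∩ L b := Finset.mem_inter.2 ⟨hxa, hxb⟩
          rw [h0] at this
          exact absurd this (Finset.notMem_empty x)
        · exact ⟨m, fun x hxa hxb => hone x m (Finset.mem_inter.2 ⟨hxa, hxb⟩) hm⟩
      obtain ⟨m, hm⟩ := key
      refine ⟨m, fun u v huv x hxu hxv => ?_⟩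
      rcases Sym2.eq_iff.1 huv with ⟨rfl, rfl⟩ | ⟨rfl, rfl⟩
      · exact hm x hxu hxv
      · exact hm x hxv hxu
  choose F hF using hex
  obtain ⟨c, hc, hcL⟩ := h F L hL
  refine ⟨Coloring.mk c fun {u v} huv heq => ?_, hcL⟩
  rcases hc u v huv with h1 | h1
  · exact h1 heq
  · exact h1 (hF ⟨s(u, v), huv⟩ u v rfl (c v) (heq ▸ hcL u) (hcL v))

/-! ### Triangles and four-cycles -/

/-- The closed walk along a triangle. -/
def triangleWalk {a b c : V} (h₁ : G.Adj a b) (h₂ : G.Adj b c) (h₃ : G.Adj c a) : G.Walk a a :=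
  .cons h₁ (.cons h₂ (.cons h₃ .nil))

/-- The closed walk along a `4`-cycle. -/
def fourWalk {a b c d : V} (h₁ : G.Adj a b) (h₂ : G.Adj b c) (h₃ : G.Adj c d) (h₄ : G.Adj d a) :
    G.Walk a a :=
  .cons h₁ (.cons h₂ (.cons h₃ (.cons h₄ .nil)))

lemma isTriangle_triangleWalk {a b c : V} (h₁ : G.Adj a b) (h₂ : G.Adj b c) (h₃ : G.Adj c a) :
    IsTriangle (triangleWalk h₁ h₂ h₃).toSubgraph := by
  refine ⟨a, triangleWalk h₁ h₂ h₃, ?_, rfl, rfl⟩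
  have := h₁.ne
  have := h₂.ne
  have := h₃.ne
  simp [triangleWalk, Walk.isCycle_def, Walk.isTrail_def]
  grind

lemma isCycleOfLength_fourWalk {a b c d : V} (h₁ : G.Adj a b) (h₂ : G.Adj b c) (h₃ : G.Adj c d)
    (h₄ : G.Adj d a) (hac : a ≠ c) (hbd : b ≠ d) :
    IsCycleOfLength (fourWalk h₁ h₂ h₃ h₄).toSubgraph 4 := by
  refine ⟨a, fourWalk h₁ h₂ h₃ h₄, ?_, rfl, rfl⟩
  have := h₁.ne
  have := h₂.ne
  have := h₃.ne
  have := h₄.ne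
  simp [fourWalk, Walk.isCycle_def, Walk.isTrail_def]
  grind

lemma NoIntersectingTriangles.trianglesDisjoint (h : G.NoIntersectingTriangles) :
    G.TrianglesDisjoint := by
  intro a b c b' c' h1 h2 h3 h4 h5 h6
  have heq : (triangleWalk h1 h2 h3).toSubgraph = (triangleWalk h4 h5 h6).toSubgraph := by
    by_contra hne
    exact h _ _ (isTriangle_triangleWalk h1 h2 h3) (isTriangle_triangleWalk h4 h5 h6) hne
      ⟨a, by simp [triangleWalk], by simp [triangleWalk]⟩
  have hb : b' ∈ (triangleWalk h1 h2 h3).toSubgraph.verts := by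
    rw [heq]
    simp [triangleWalk]
  have := h4.ne
  simp [triangleWalk] at hb
  grind

/-- The two 4-cycles are adjacent to the triangle abc, hence equal, so one 4-cycle abcq contains
both edges ab and bc. Its chord ca gives a second triangle acq at a, which the disjointness of
triangles excludes. -/
lemma TrianglesAdjacentToAtMostOneFourCycle.triangleFourCycleSparse
    (h : G.TrianglesAdjacentToAtMostOneFourCycle) (h' : G.TrianglesDisjoint) :
    G.TriangleFourCycleSparse := by
  intro a b c p q r s hab hbc hca hbp hpq hqa hap hbq hcr hrs hsb hbr hcs
  have heq := h _ (isTriangle_triangleWalk hab hbc hca) _ _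
    (isCycleOfLength_fourWalk hab hbp hpq hqa hap hbq)
    (isCycleOfLength_fourWalk hbc hcr hrs hsb hbr hcs)
    ⟨s(a, b), by simp [triangleWalk], by simp [fourWalk]⟩
    ⟨s(b, c), by simp [triangleWalk], by simp [fourWalk]⟩
  have hmem : s(b, c) ∈ (fourWalk hab hbp hpq hqa).toSubgraph.edgeSet := by
    rw [heq]
    simp [fourWalk]
  have hcp : c = p := by
    rw [Walk.mem_edges_toSubgraph] at hmem
    simp [fourWalk] at hmem
    have := hab.ne
    have := hbp.ne
    have := hca.ne
    grind
  subst hcp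
  rcases h' a b c c q hab hbc hca hca.symm hpq hqa with h1 | h1
  · exact hbc.ne h1.symm
  · have := h' a c q b c hca.symm hpq hqa hab hbc hca
    grind [hbc.ne]

end SimpleGraph

open SimpleGraph in
theorem theorem3p3 {V : Type*} [Finite V] (G : SimpleGraph V) (hplanar : G.IsPlanar)
    (htri : G.NoIntersectingTriangles)
    (hfour : G.TrianglesAdjacentToAtMostOneFourCycle) :
    G.adaptableChoiceNumber ≤ 3 ∧ G.SeparatedChoosable 3 1 := by
  have h₁ := htri.trianglesDisjoint
  have h₂ := hfour.triangleFourCycleSparse h₁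
  obtain ⟨f, hf, hmem⟩ := exists_injective_of_card_edgeSet_le fun s : Set V =>
    card_edgeSet_le (hplanar.induce s) (h₁.induce s) (h₂.induce s)
  have h3 := AdaptablyChoosable.of_injective hf hmem
  exact ⟨iInf₂_le 3 h3, h3.separatedChoosable⟩
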